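/- **Definitions.** A linear permutation of length $n$ is a sequence $\pi=\pi_1\cdots\pi_n$ of $n$ distinct positive integers ($n\ge 0$); the cyclic permutation $[\pi]$ is its class under rotation, and $|\pi|=n$. A cyclic permutation statistic is a function $\mathrm{cst}$ on cyclic permutations with $\mathrm{cst}[\pi]=\mathrm{cst}[\sigma]$ whenever $\pi$ and $\sigma$ have the same relative order. For $\pi,\sigma$ without common letters, $\mathrm{Sh}([\pi],[\sigma])$ is the set of all $[\tau]$ such that some representative of $[\tau]$, of length $|\pi|+|\sigma|$, contains representatives of $[\pi]$ and $[\sigma]$ as subsequences. The statistic is *cyclic shuffle-compatible* if the multiset of values of $\mathrm{cst}$ on $\mathrm{Sh}([\pi],[\sigma])$ depends only on $\mathrm{cst}[\pi]$, $\mathrm{cst}[\sigma]$, $|\pi|$, $|\sigma|$. Cyclic permutations are $\mathrm{cst}$-equivalent if they have the same length and the same value of $\mathrm{cst}$; write $[\pi]_{\mathrm{cst}}$ for the class. If $\mathrm{cst}$ is cyclic shuffle-compatible, its *cyclic shuffle algebra* $\mathcal A^{\mathrm{cyc}}_{\mathrm{cst}}$ is the $\mathbb Q$-vector space with the $\mathrm{cst}$-equivalence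 classes as basis and product $[\pi]_{\mathrm{cst}}[\sigma]_{\mathrm{cst}}=\sum_{[\tau]\in\mathrm{Sh}([\pi],[\sigma])}[\tau]_{\mathrm{cst}}$ for disjoint $\pi,\sigma$. The cyclic descent set of $\pi$ is $\mathrm{cDes}\,\pi=\{i\in[n]:\pi_i>\pi_{i+1}\}$, indices modulo $n$. A set $S\subseteq[n]$ is *non-Escher* if $S=\mathrm{cDes}\,\pi$ for some $\pi$ of length $n$. For such $S=\{s_1<\dots<s_j\}$ let $\mathrm{cComp}[S]$ be the class under rotation of the composition $(s_2-s_1,\dots,s_j-s_{j-1},n-s_j+s_1)$ if $n\ge2$, of $(1)$ if $n=1$, and of the empty composition if $n=0$; classes of this form are the *non-Escher cyclic compositions*, and $\mathrm{cComp}[\pi]=\mathrm{cComp}[\mathrm{cDes}\,\pi]$. A *cyclic descent statistic* is a cyclic permutation statistic for which $\mathrm{cComp}[\pi]=\mathrm{cComp}[\sigma]$ implies $\mathrm{cst}[\pi]=\mathrm{cst}[\sigma]$. Then $\mathrm{cst}[L]$ denotes the value of $\mathrm{cst}$ on any $[\pi]$ with $\mathrm{cComp}[\pi]=[L]$, and non-Escher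 cyclic compositions of the same size (sum of the parts) and with the same value of $\mathrm{cst}$ are called $\mathrm{cst}$-equivalent. For $S\subseteq[n-1]$ let $F_{n,S}=\sum x_{i_1}\cdots x_{i_n}$, over $i_1\le\dots\le i_n$ with $i_j<i_{j+1}$ for $j\in S$. For $S\subseteq[n]$, $n\ge1$, let $F^{\mathrm{cyc}}_{n,S}=\sum_{i=1}^nF_{n,(S+i)\cap[n-1]}$, where $S+i$ is taken modulo $n$ in $[n]$, and let $F^{\mathrm{cyc}}_{0,\emptyset}=1$. For a composition $L=(L_1,\dots,L_k)$ of $n$ let $F^{\mathrm{cyc}}_{[L]}=F^{\mathrm{cyc}}_{n,\{L_1,L_1+L_2,\dots,L_1+\cdots+L_k\}}$. Let $\mathrm{cQSym}^-\subseteq\mathbb Q[[x_1,x_2,\dots]]$ be the $\mathbb Q$-linear span of all $F^{\mathrm{cyc}}_{n,S}$ with $n\ge0$ and $S\subseteq[n]$ non-Escher. **Theorem 3.5.** $\mathrm{cQSym}^-$ is a $\mathbb Q$-subalgebra of $\mathbb Q[[x_1,x_2,\dots]]$. Let $\mathrm{cst}$ be a cyclic descent statistic. Then $\mathrm{cst}$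 is cyclic shuffle-compatible if and only if there exist a $\mathbb Q$-algebra $A$ with a basis $\{v_\alpha\}$ indexed by the $\mathrm{cst}$-equivalence classes $\alpha$ of non-Escher cyclic compositions and a $\mathbb Q$-algebra homomorphism $\phi_{\mathrm{cst}}\colon\mathrm{cQSym}^-\to A$ such that $\phi_{\mathrm{cst}}(F^{\mathrm{cyc}}_{[L]})=v_\alpha$ whenever $[L]\in\alpha$. In this case, for every such $A$, $\{v_\alpha\}$ and $\phi_{\mathrm{cst}}$, the linear map $\mathcal A^{\mathrm{cyc}}_{\mathrm{cst}}\to A$ defined by $[\pi]_{\mathrm{cst}}\mapsto v_\alpha$, where $\mathrm{cComp}[\pi]\in\alpha$, is a $\mathbb Q$-algebra isomorphism. Consequently, the cyclic shuffle algebra of every cyclic shuffle-compatible cyclic descent statistic is isomorphic to a quotient algebra of $\mathrm{cQSym}^-$. -/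

import Mathlib

noncomputable section

namespace CyclicShuffle

/-! ## Cyclic permutations, cyclic descents and cyclic shuffles -/

/-- A linear permutation is a list of distinct positive integers; a cyclic permutation is the class
of a linear permutation under rotation (`Cycle` is the type of lists up to rotation). -/
def CyclicPerm : Type := {c : Cycle ℕ+ // c.Nodup}

namespace CyclicPerm

/-- The cyclic permutation `[π]` of a linear permutation `π`. -/
def ofList (l : List ℕ+) (h : l.Nodup) : CyclicPerm := ⟨(l : Cycle ℕ+), Cycle.nodup_coe_iff.2 h⟩

/-- The length of a cyclic permutation. -/
def length (π : CyclicPerm) : ℕ := π.1.length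

/-- The set of letters of a cyclic permutation. -/
def letters (π : CyclicPerm) : Finset ℕ+ := π.1.toFinset

end CyclicPerm

/-- Two lists have the same relative order: they have the same length and their entries compare in
the same way (for lists of distinct letters: they have the same standardization). -/
def SameRelOrder (p q : List ℕ+) : Prop :=
  ∃ h : p.length = q.length,
    ∀ i j : Fin p.length, p.get i < p.get j ↔ q.get (i.cast h) < q.get (j.cast h)

/-- `t` is a shuffle of the disjoint linear permutations `p` and `s`: it is a linear permutation of length `|p| + |s|` that has `p` and `s` as subsequences. -/
def IsShuffle (p s t : List ℕ+) : Prop :=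
  p.Disjoint s ∧ t.Nodup ∧ t.length = p.length + s.length ∧ p.Sublist t ∧ s.Sublist t

/-- `τ` is a cyclic shuffle of `π` and `σ`: some representative of `τ` is a linear shuffle of
representatives of `π` and `σ`. -/
def IsCyclicShuffle (π σ τ : CyclicPerm) : Prop :=
  ∃ p s t : List ℕ+, (p : Cycle ℕ+) = π.1 ∧ (s : Cycle ℕ+) = σ.1 ∧ (t : Cycle ℕ+) = τ.1 ∧
    IsShuffle p s t

/-- The cyclic descent set of the linear permutation `π_1 ⋯ π_n`: all `i ∈ [n]` with
`π_i > π_{i+1}`, indices modulo `n`. List positions start at `0`, so `π_i` is the entry at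
position `i - 1` and `π_{i+1}` the entry at position `i % n`; the default value `1` of `getD` is
never used. -/
def cDes (l : List ℕ+) : Finset ℕ :=
  (Finset.Icc 1 l.length).filter fun i => l.getD (i % l.length) 1 < l.getD (i - 1) 1

/-- The cyclic shift `S + i` of `S ⊆ [n]`, values taken modulo `n` in `[n] = {1, …, n}`. -/
def cycShift (n : ℕ) (S : Finset ℕ) (i : ℕ) : Finset ℕ := S.image fun s => (s + i - 1) % n + 1

/-- The composition `(s₂ - s₁, …, s_j - s_{j-1}, n - s_j + s₁)` of `n` attached to a subset
`S = {s₁ < ⋯ < s_j}` of `[n]` when `n ≥ 2`; it is `(1)` for `n = 1` and empty for `n = 0`.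
The differences are positive, so `Nat.toPNat'` does not change them. -/
def cComp (n : ℕ) (S : Finset ℕ) : List ℕ+ :=
  if n = 0 then [] else if n = 1 then [1] else
    List.zipWith (fun a b => (b - a).toPNat') (S.sort (· ≤ ·))
      ((S.sort (· ≤ ·)).tail ++ [n + (S.sort (· ≤ ·)).headD 0])

/-! ### Compatibility with rotation -/

theorem eq_of_isRotated {α β : Type*} (f : List α → β)
    (hf : ∀ a l, f (a :: l) = f (l ++ [a])) {l l' : List α} (h : l ~r l') : f l = f l' := by
  obtain ⟨n, rfl⟩ := h
  induction n with
  | zero => simp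
  | succ n ih =>
    rw [ih, ← List.rotate_rotate]
    cases l.rotate n with
    | nil => simp
    | cons a m => simpa using hf a m

theorem cDes_cons (a : ℕ+) (l : List ℕ+) :
    cDes (a :: l) = cycShift (l.length + 1) (cDes (l ++ [a])) 1 := by
  have key : ∀ k < l.length + 1,
      (l ++ [a]).getD k 1 = (a :: l).getD ((k + 1) % (l.length + 1)) 1 := by
    intro k hk
    rcases Nat.lt_succ_iff_lt_or_eq.1 hk with h | rfl
    · rw [Nat.mod_eq_of_lt (by omega)]
      simp [List.getD, List.getElem?_append_left h]
    · simp
  ext i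
  simp only [cDes, cycShift, Finset.mem_image, Finset.mem_filter, Finset.mem_Icc,
    List.length_append, List.length_cons, List.length_nil, zero_add, Nat.add_sub_cancel]
  have step : ∀ j, 1 ≤ j → j ≤ l.length + 1 →
      ((l ++ [a]).getD (j % (l.length + 1)) 1 < (l ++ [a]).getD (j - 1) 1 ↔
      (a :: l).getD ((j % (l.length + 1) + 1) % (l.length + 1)) 1 <
        (a :: l).getD (j % (l.length + 1) + 1 - 1) 1) := by
    intro j h1 h2
    rw [key _ (Nat.mod_lt _ (by omega)), key (j - 1) (by omega), Nat.sub_add_cancel h1,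
      Nat.add_sub_cancel]
  constructor
  · rintro ⟨⟨h1, h2⟩, h3⟩
    have hj : ∃ j, 1 ≤ j ∧ j ≤ l.length + 1 ∧ j % (l.length + 1) + 1 = i := by
      by_cases hi : i = 1
      · exact ⟨l.length + 1, by omega, le_rfl, by simp [hi]⟩
      · exact ⟨i - 1, by omega, by omega, by rw [Nat.mod_eq_of_lt (by omega)]; omega⟩
    obtain ⟨j, hj1, hj2, rfl⟩ := hj
    exact ⟨j, ⟨⟨hj1, hj2⟩, (step j hj1 hj2).2 h3⟩, rfl⟩
  · rintro ⟨j, ⟨⟨h1, h2⟩, h3⟩, rfl⟩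
    have := Nat.mod_lt j (show l.length + 1 > 0 by omega)
    exact ⟨⟨by omega, by omega⟩, (step j h1 h2).1 h3⟩

theorem cDes_subset (l : List ℕ+) : cDes l ⊆ Finset.Icc 1 l.length := Finset.filter_subset _ _

theorem cComp_cycShift (n : ℕ) (S : Finset ℕ) (hS : S ⊆ Finset.Icc 1 n) :
    (cComp n (cycShift n S 1) : List ℕ+) ~r cComp n S := by
  rcases Nat.lt_or_ge n 2 with h2 | h2
  · have h : n = 0 ∨ n = 1 := by omega
    rcases h with rfl | rfl <;> simp [cComp]
  have hsort : ∀ (T : Finset ℕ) (l : List ℕ), l.Pairwise (· < ·) → l.toFinset = T →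
      T.sort (· ≤ ·) = l := by
    rintro T l hl rfl
    exact (List.toFinset_sort (· ≤ ·) hl.nodup).2 (hl.imp fun h => h.le)
  have hcomp : ∀ (T : Finset ℕ) (l : List ℕ), l.Pairwise (· < ·) → l.toFinset = T →
      cComp n T = List.zipWith (fun a b => (b - a).toPNat') l (l.tail ++ [n + l.headD 0]) := by
    intro T l hl hT
    rw [cComp, if_neg (by omega), if_neg (by omega), hsort T l hl hT]
  obtain ⟨l, hl, rfl⟩ : ∃ l : List ℕ, l.Pairwise (· < ·) ∧ l.toFinset = S :=
    ⟨S.sort (· ≤ ·), S.sortedLT_sort.pairwise, S.sort_toFinset _⟩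
  have hmem : ∀ x ∈ l, 1 ≤ x ∧ x ≤ n := fun x hx => Finset.mem_Icc.1 (hS (by simpa using hx))
  by_cases hn : n ∈ l
  · obtain ⟨r, r', rfl⟩ := List.append_of_mem hn
    have hr' : r' = [] := by
      rcases r' with _ | ⟨x, r'⟩
      · rfl
      · have h1 := hmem x (by simp)
        have h3 := (List.pairwise_append.1 hl).2.1
        have h4 := (List.pairwise_cons.1 h3).1 x (by simp)
        omega
    subst hr'
    have hr : ∀ x ∈ r, 1 ≤ x ∧ x < n := fun x hx =>
      ⟨(hmem x (by simp [hx])).1, (List.pairwise_append.1 hl).2.2 x hx n (by simp)⟩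
    have hrs := (List.pairwise_append.1 hl).1
    have e1 : cycShift n (r ++ [n]).toFinset 1 = (1 :: r.map (· + 1)).toFinset := by
      ext i
      simp only [cycShift, Finset.mem_image, List.mem_toFinset, List.mem_append, List.mem_cons,
        List.mem_map, Nat.add_sub_cancel, List.not_mem_nil, or_false]
      constructor
      · rintro ⟨s, hs | rfl, rfl⟩
        · exact Or.inr ⟨s, hs, by rw [Nat.mod_eq_of_lt (hr s hs).2]⟩
        · simp
      · rintro (rfl | ⟨s, hs, rfl⟩)
        · exact ⟨n, by simp⟩
        · exact ⟨s, Or.inl hs, by rw [Nat.mod_eq_of_lt (hr s hs).2]⟩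
    rw [hcomp _ _ hl rfl, hcomp _ _ ?_ e1.symm]
    · have e2 : (1 :: r.map (· + 1)) = (0 :: r).map (· + 1) := by simp
      have e3 : r.map (· + 1) ++ [n + 1] = (r ++ [n]).map (· + 1) := by simp
      have e4 : ∀ a b : ℕ, (b + 1 - (a + 1)).toPNat' = (b - a).toPNat' := by
        intro a b; congr 1; omega
      have e5 : List.zipWith (fun a b => (b - a).toPNat') (1 :: r.map (· + 1))
          (r.map (· + 1) ++ [n + 1]) =
          List.zipWith (fun a b => (b - a).toPNat') (0 :: r) (r ++ [n]) := by
        rw [e2, e3, List.zipWith_map]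
        simp only [e4]
      simp only [List.tail_cons, List.headD_cons]
      rw [e5]
      rcases r with _ | ⟨b, r⟩
      · simp
      · have e6 : List.zipWith (fun a b => (b - a).toPNat') (b :: r ++ [n])
            ((b :: r ++ [n]).tail ++ [n + (b :: r ++ [n]).headD 0]) =
            List.zipWith (fun a b => (b - a).toPNat') (b :: r) (r ++ [n]) ++ [b.toPNat'] := by
          have : (b :: r ++ [n]).tail ++ [n + (b :: r ++ [n]).headD 0] =
            (r ++ [n]) ++ [n + b] := by simp
          rw [this, List.zipWith_append (by simp)]
          simp
        rw [e6]
        simp only [List.cons_append, List.zipWith_cons_cons, Nat.sub_zero]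
        exact ⟨1, by simp⟩
    · simp only [List.pairwise_cons, List.mem_map, List.pairwise_map]
      refine ⟨?_, hrs.imp fun h => by omega⟩
      rintro _ ⟨x, hx, rfl⟩
      have := hr x hx
      omega
  · have hr : ∀ x ∈ l, x < n := fun x hx =>
      lt_of_le_of_ne (hmem x hx).2 (by rintro rfl; exact hn hx)
    have e1 : cycShift n l.toFinset 1 = (l.map (· + 1)).toFinset := by
      ext i
      simp only [cycShift, Finset.mem_image, List.mem_toFinset, List.mem_map, Nat.add_sub_cancel]
      constructor
      · rintro ⟨s, hs, rfl⟩
        exact ⟨s, hs, by rw [Nat.mod_eq_of_lt (hr s hs)]⟩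
      · rintro ⟨s, hs, rfl⟩
        exact ⟨s, hs, by rw [Nat.mod_eq_of_lt (hr s hs)]⟩
    rw [hcomp _ _ hl rfl, hcomp _ _ ?_ e1.symm]
    · rcases l with _ | ⟨b, r⟩
      · simp
      · have e3 : r.map (· + 1) ++ [n + (b + 1)] = (r ++ [n + b]).map (· + 1) := by
          simp [add_assoc]
        have e4 : ∀ a b : ℕ, (b + 1 - (a + 1)).toPNat' = (b - a).toPNat' := by
          intro a b; congr 1; omega
        simp only [List.map_cons, List.tail_cons, List.headD_cons]
        rw [e3, ← List.map_cons (f := (· + 1)), List.zipWith_map]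
        simp only [e4]
        exact List.IsRotated.refl _
    · simp only [List.pairwise_map]
      exact hl.imp fun h => by omega

/-- The cyclic composition `[cComp (cDes π)]` of a list up to rotation. -/
def cycleComp (c : Cycle ℕ+) : Cycle ℕ+ :=
  Quotient.liftOn c (fun l => ((cComp l.length (cDes l) : List ℕ+) : Cycle ℕ+)) <| by
    intro l l' h
    refine eq_of_isRotated (fun l => ((cComp l.length (cDes l) : List ℕ+) : Cycle ℕ+)) ?_ h
    intro a l
    have h1 := cComp_cycShift (l.length + 1) (cDes (l ++ [a])) (by
      simpa using cDes_subset (l ++ [a]))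
    rw [← cDes_cons] at h1
    simpa using h1

/-- The cyclic descent composition of a cyclic permutation. -/
def CyclicPerm.cComp (π : CyclicPerm) : Cycle ℕ+ := cycleComp π.1

/-! ## Quasisymmetric functions -/

/-- The fundamental quasisymmetric function `F_{n,S}`, `S ⊆ [n-1]`, as a formal power series in
`x₁, x₂, …`: the sum of `x_{i₁} ⋯ x_{i_n}` over `i₁ ≤ ⋯ ≤ i_n` with `i_j < i_{j+1}` for `j ∈ S`.
The coefficient of a monomial counts the index sequences that produce this monomial. The entry
`i_j` is the value of the sequence at position `j - 1`. -/
def fundQSym (n : ℕ) (S : Finset ℕ) : MvPowerSeries ℕ+ ℚ := fun d =>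
  (Nat.card {i : Fin n → ℕ+ // Monotone i ∧
    (∀ j k : Fin n, k.1 = j.1 + 1 → k.1 ∈ S → i j < i k) ∧
    ∑ j, Finsupp.single (i j) 1 = d} : ℚ)

/-- The fundamental cyclic quasisymmetric function `F^cyc_{n,S}`, `S ⊆ [n]`. -/
def fundCycQSym (n : ℕ) (S : Finset ℕ) : MvPowerSeries ℕ+ ℚ :=
  if n = 0 then 1 else
    ∑ i ∈ Finset.Icc 1 n, fundQSym n (cycShift n S i ∩ Finset.Icc 1 (n - 1))

/-- The cyclic descent set `{L₁, L₁ + L₂, …, L₁ + ⋯ + L_k} ⊆ [n]` of a composition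
`L = (L₁, …, L_k)` of `n`. Up to cyclic shift it is inverse to `cComp`. -/
def compDes (L : List ℕ+) : Finset ℕ :=
  (Finset.Icc 1 L.length).image fun k => ((L.take k).map (fun a : ℕ+ => (a : ℕ))).sum

/-- The size of a list of positive integers regarded as a composition. -/
def size (L : List ℕ+) : ℕ := (L.map (fun a : ℕ+ => (a : ℕ))).sum

theorem fundCycQSym_cycShift (n : ℕ) (S : Finset ℕ) (hS : S ⊆ Finset.Icc 1 n) (a : ℕ) :
    fundCycQSym n (cycShift n S a) = fundCycQSym n S := by
  rcases Nat.eq_zero_or_pos n with rfl | hn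
  · simp [fundCycQSym]
  have hper : ∀ (g : ℕ → MvPowerSeries ℕ+ ℚ), (∀ i, g (i + n) = g i) → ∀ a,
      ∑ i ∈ Finset.Icc 1 n, g (a + i) = ∑ i ∈ Finset.Icc 1 n, g i := by
    intro g hg a
    induction a with
    | zero => simp
    | succ a ih =>
      rw [← ih]
      have h1 : ∀ f : ℕ → MvPowerSeries ℕ+ ℚ,
          ∑ i ∈ Finset.Icc 1 n, f i = ∑ i ∈ Finset.range n, f (i + 1) := by
        intro f
        rw [Finset.range_eq_Ico, Finset.sum_Ico_add' f 0 n 1, zero_add]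
        rfl
      rw [h1, h1]
      have h2 := Finset.sum_range_succ (fun i => g (a + (i + 1))) n
      have h3 := Finset.sum_range_succ' (fun i => g (a + (i + 1))) n
      have h4 : g (a + (n + 1)) = g (a + (0 + 1)) := by
        rw [← hg (a + (0 + 1))]; congr 1; ring
      rw [h2, h4] at h3
      have h5 := add_right_cancel h3
      rw [h5]
      exact Finset.sum_congr rfl fun i _ => by congr 1; ring
  have hS1 : ∀ s ∈ S, 1 ≤ s := fun s hs => (Finset.mem_Icc.1 (hS hs)).1
  have hshift : ∀ i, cycShift n (cycShift n S a) i = cycShift n S (a + i) := by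
    intro i
    rw [cycShift, cycShift, cycShift, Finset.image_image]
    refine Finset.image_congr fun s hs => ?_
    have := hS1 s hs
    change ((s + a - 1) % n + 1 + i - 1) % n + 1 = (s + (a + i) - 1) % n + 1
    have e1 : (s + a - 1) % n + 1 + i - 1 = (s + a - 1) % n + i := by omega
    have e2 : s + (a + i) - 1 = (s + a - 1) + i := by omega
    rw [e1, e2, Nat.mod_add_mod]
  rw [fundCycQSym, fundCycQSym, if_neg hn.ne', if_neg hn.ne']
  simp only [hshift]
  refine hper (fun i => fundQSym n (cycShift n S i ∩ Finset.Icc 1 (n - 1))) (fun i => ?_) a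
  have : cycShift n S (i + n) = cycShift n S i := by
    refine Finset.image_congr fun s hs => ?_
    have := hS1 s hs
    have e : s + (i + n) - 1 = (s + i - 1) + n := by omega
    rw [e, Nat.add_mod_right]
  simp only [this]

theorem compDes_cons (a : ℕ+) (l : List ℕ+) :
    compDes (a :: l) = insert (a : ℕ) ((compDes l).image fun x : ℕ => (a : ℕ) + x) := by
  ext x
  simp only [compDes, Finset.mem_image, Finset.mem_insert, Finset.mem_Icc, List.length_cons]
  constructor
  · rintro ⟨k, ⟨h1, h2⟩, rfl⟩
    obtain ⟨k, rfl⟩ : ∃ m, k = m + 1 := ⟨k - 1, by omega⟩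
    rcases k with _ | k
    · simp
    · exact Or.inr ⟨_, ⟨k + 1, ⟨by omega, by omega⟩, rfl⟩, by simp⟩
  · rintro (rfl | ⟨_, ⟨k, ⟨h1, h2⟩, rfl⟩, rfl⟩)
    · exact ⟨1, ⟨le_rfl, by omega⟩, by simp⟩
    · exact ⟨k + 1, ⟨by omega, by omega⟩, by simp⟩

theorem size_cons (a : ℕ+) (l : List ℕ+) : size (a :: l) = a + size l := by simp [size]

theorem compDes_concat (a : ℕ+) (l : List ℕ+) :
    compDes (l ++ [a]) = insert (size l + a) (compDes l) := by
  induction l with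
  | nil => rw [List.nil_append, compDes_cons]; simp [compDes, size]
  | cons b l ih =>
    rw [List.cons_append, compDes_cons, ih, compDes_cons, Finset.image_insert, size_cons,
      Finset.insert_comm]
    simp [add_assoc]

theorem compDes_subset (L : List ℕ+) : compDes L ⊆ Finset.Icc 1 (size L) := by
  induction L with
  | nil => simp [compDes]
  | cons a l ih =>
    have ha := a.pos
    rw [compDes_cons, size_cons]
    intro x hx
    simp only [Finset.mem_insert, Finset.mem_image] at hx
    rw [Finset.mem_Icc]
    rcases hx with rfl | ⟨y, hy, rfl⟩
    · omega
    · have := Finset.mem_Icc.1 (ih hy)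
      omega

theorem compDes_append (a : ℕ+) (l : List ℕ+) :
    compDes (a :: l) = cycShift (size (a :: l)) (compDes (l ++ [a])) a := by
  have ha := a.pos
  rw [compDes_cons, compDes_concat, cycShift, Finset.image_insert, size_cons]
  congr 1
  · have : size l + ↑a + ↑a - 1 = (a - 1) + (a + size l) := by omega
    rw [this, Nat.add_mod_right, Nat.mod_eq_of_lt (by omega), Nat.sub_add_cancel ha]
  · refine Finset.image_congr fun x hx => ?_
    have := Finset.mem_Icc.1 (compDes_subset l hx)
    have e : x + a - 1 = (a + x) - 1 := by omega
    rw [e, Nat.mod_eq_of_lt (by omega)]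
    omega

theorem size_append (a : ℕ+) (l : List ℕ+) : size (l ++ [a]) = size (a :: l) := by
  simp [size, add_comm]

/-- The size of a cyclic composition (a list of positive integers up to rotation). -/
def cycSize (c : Cycle ℕ+) : ℕ :=
  Quotient.liftOn c size fun _ _ h => eq_of_isRotated size (fun a l => (size_append a l).symm) h

/-- `F^cyc_{[L]} = F^cyc_{n, cDes L}` for the cyclic composition `[L]` of `n`. -/
def fundCycQSymComp (c : Cycle ℕ+) : MvPowerSeries ℕ+ ℚ :=
  Quotient.liftOn c (fun L => fundCycQSym (size L) (compDes L)) fun _ _ h =>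
    eq_of_isRotated (fun L => fundCycQSym (size L) (compDes L)) (by
      intro a l
      have := fundCycQSym_cycShift (size (a :: l)) (compDes (l ++ [a]))
        (size_append a l ▸ compDes_subset (l ++ [a])) a
      rw [← compDes_append] at this
      simp only [this, size_append]) h

/-- A subset of `[n]` is non-Escher if it is the cyclic descent set of a linear permutation of
length `n`. -/
def IsNonEscher (n : ℕ) (S : Finset ℕ) : Prop :=
  ∃ l : List ℕ+, l.Nodup ∧ l.length = n ∧ cDes l = S

/-- A cyclic composition is non-Escher if it is `[cComp S]` for a non-Escher subset `S` of some
`[n]`. -/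
def IsNonEscherComp (c : Cycle ℕ+) : Prop :=
  ∃ (n : ℕ) (S : Finset ℕ), IsNonEscher n S ∧ ((cComp n S : List ℕ+) : Cycle ℕ+) = c

theorem cDes_nonempty (l : List ℕ+) (hl : l.Nodup) (h2 : 2 ≤ l.length) : (cDes l).Nonempty := by
  have : Nonempty (Fin l.length) := ⟨⟨0, by omega⟩⟩
  obtain ⟨m, hm⟩ := Finite.exists_max fun i : Fin l.length => l.get i
  have hlt : (m.1 + 1) % l.length < l.length := Nat.mod_lt _ (by omega)
  refine ⟨m.1 + 1, ?_⟩
  simp only [cDes, Finset.mem_filter, Finset.mem_Icc, Nat.add_sub_cancel]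
  refine ⟨⟨by omega, m.2⟩, ?_⟩
  rw [List.getD_eq_getElem _ _ hlt, List.getD_eq_getElem _ _ m.2]
  refine lt_of_le_of_ne (hm ⟨_, hlt⟩) fun h => ?_
  have h3 := (hl.getElem_inj_iff).1 h
  by_cases h4 : m.1 + 1 = l.length
  · rw [h4, Nat.mod_self] at h3
    omega
  · rw [Nat.mod_eq_of_lt (by omega)] at h3
    omega

theorem compDes_gaps (N : ℕ) (r : List ℕ) : ∀ b : ℕ, (b :: (r ++ [N])).Pairwise (· < ·) →
    size (List.zipWith (fun a b => (b - a).toPNat') (b :: r) (r ++ [N])) = N - b ∧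
    compDes (List.zipWith (fun a b => (b - a).toPNat') (b :: r) (r ++ [N])) =
      (r ++ [N]).toFinset.image (· - b) := by
  induction r with
  | nil =>
    intro b hb
    have : b < N := by simpa using hb
    have hp : ((N - b).toPNat' : ℕ) = N - b := by
      rw [Nat.toPNat'_coe, if_pos (by omega)]
    constructor
    · simp [size, hp]
    · simp [compDes, hp]
  | cons c r ih =>
    intro b hb
    obtain ⟨h1, h2⟩ := List.pairwise_cons.1 hb
    obtain ⟨h3, h4⟩ := List.pairwise_cons.1 h2
    have hbc : b < c := h1 c (by simp)
    have hcN : c < N := h3 N (by simp)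
    have hp : ((c - b).toPNat' : ℕ) = c - b := by
      rw [Nat.toPNat'_coe, if_pos (by omega)]
    obtain ⟨i1, i2⟩ := ih c h2
    rw [List.cons_append, List.zipWith_cons_cons, size_cons, compDes_cons, i1, i2, hp]
    refine ⟨by omega, ?_⟩
    rw [List.toFinset_cons, Finset.image_insert, Finset.image_image]
    congr 1
    refine Finset.image_congr fun x hx => ?_
    have := h3 x (by simpa [or_comm] using hx)
    simp only [Function.comp]
    omega

/-- For a non-Escher subset `S` of `[n]`, the cyclic composition `[cComp S]` has size `n`, and its
fundamental cyclic quasisymmetric function is the one of `S`. -/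
theorem fundCycQSymComp_cComp {n : ℕ} {S : Finset ℕ} (h : IsNonEscher n S) :
    cycSize (cComp n S : List ℕ+) = n ∧
      fundCycQSymComp (cComp n S : List ℕ+) = fundCycQSym n S := by
  change size (cComp n S) = n ∧
    fundCycQSym (size (cComp n S)) (compDes (cComp n S)) = fundCycQSym n S
  obtain ⟨l, hl, rfl, rfl⟩ := h
  set n := l.length with hn
  set S := cDes l with hS
  have hS1 : S ⊆ Finset.Icc 1 n := cDes_subset l
  rcases Nat.lt_or_ge n 2 with h2 | h2
  · have h : n = 0 ∨ n = 1 := by omega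
    rcases h with h | h
    · rw [h]; simp [cComp, size, fundCycQSym]
    · rw [h]; simp [cComp, size, fundCycQSym]
  have hne := cDes_nonempty l hl h2
  obtain ⟨b, r, hbr⟩ : ∃ b r, S.sort (· ≤ ·) = b :: r := by
    rcases hs : S.sort (· ≤ ·) with _ | ⟨b, r⟩
    · have := congrArg List.toFinset hs
      rw [Finset.sort_toFinset] at this
      simp [S] at this
      simp [this] at hne
    · exact ⟨b, r, rfl⟩
  have hsorted : (b :: r).Pairwise (· < ·) := hbr ▸ S.sortedLT_sort.pairwise
  have hSl : (b :: r).toFinset = S := by rw [← hbr, Finset.sort_toFinset]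
  have hmem : ∀ x ∈ b :: r, 1 ≤ x ∧ x ≤ n := fun x hx =>
    Finset.mem_Icc.1 (hS1 (hSl ▸ List.mem_toFinset.2 hx))
  have hb := hmem b (by simp)
  obtain ⟨hb1, hb2⟩ := List.pairwise_cons.1 hsorted
  obtain ⟨g1, g2⟩ := compDes_gaps (n + b) r b (by
    rw [← List.cons_append, List.pairwise_append]
    refine ⟨hsorted, by simp, fun x hx y hy => ?_⟩
    have := hmem x hx
    have : y = n + b := by simpa using hy
    omega)
  have e : cComp n S = List.zipWith (fun a b => (b - a).toPNat') (b :: r) (r ++ [n + b]) := by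
    rw [cComp, if_neg (by omega), if_neg (by omega), hbr]
    rfl
  rw [e, g1, g2, Nat.add_sub_cancel]
  refine ⟨rfl, ?_⟩
  rw [← fundCycQSym_cycShift n S hS1 (n - b), ← hSl]
  congr 1
  have e1 : ∀ s ∈ r, (s + (n - b) - 1) % n + 1 = s - b := by
    intro s hs
    have h3 := hmem s (by simp [hs])
    have h4 := hb1 s hs
    have : s + (n - b) - 1 = (s - b - 1) + n := by omega
    rw [this, Nat.add_mod_right, Nat.mod_eq_of_lt (by omega)]
    omega
  have e2 : (b + (n - b) - 1) % n + 1 = n := by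
    rw [Nat.mod_eq_of_lt (by omega)]; omega
  ext x
  simp only [cycShift, Finset.mem_image, List.mem_toFinset, List.mem_append, List.mem_cons,
    List.not_mem_nil, or_false]
  constructor
  · rintro ⟨s, hs | rfl, rfl⟩
    · exact ⟨s, Or.inr hs, e1 s hs⟩
    · exact ⟨b, Or.inl rfl, by omega⟩
  · rintro ⟨s, rfl | hs, rfl⟩
    · exact ⟨n + s, Or.inr rfl, by omega⟩
    · exact ⟨s, Or.inl hs, (e1 s hs).symm⟩

/-- The non-Escher cyclic compositions. -/
def NonEscherComp : Type := {c : Cycle ℕ+ // IsNonEscherComp c}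

theorem isNonEscherComp_cComp (π : CyclicPerm) : IsNonEscherComp π.cComp := by
  obtain ⟨c, hc⟩ := π
  induction c using Quotient.inductionOn with
  | h l => exact ⟨l.length, cDes l, ⟨l, hc, rfl, rfl⟩, rfl⟩

theorem exists_cComp_eq (L : NonEscherComp) : ∃ π : CyclicPerm, π.cComp = L.1 := by
  obtain ⟨c, n, S, ⟨l, hl, rfl, rfl⟩, rfl⟩ := L
  exact ⟨CyclicPerm.ofList l hl, rfl⟩

/-- The cyclic descent composition of a cyclic permutation, as a non-Escher cyclic composition. -/
def CyclicPerm.nonEscherComp (π : CyclicPerm) : NonEscherComp := ⟨π.cComp, isNonEscherComp_cComp π⟩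

/-- The set of all `F^cyc_{n,[S]}`, `n ≥ 0`, `S ⊆ [n]` non-Escher. -/
def nonEscherFund : Set (MvPowerSeries ℕ+ ℚ) :=
  {f | ∃ (n : ℕ) (S : Finset ℕ), IsNonEscher n S ∧ f = fundCycQSym n S}

/-- The non-Escher algebra `cQSym⁻`: the subalgebra of the algebra of formal power series generated
by all `F^cyc_{n,[S]}`, `S ⊆ [n]` non-Escher. The theorem asserts that it is also the linear span of
these functions. -/
def cQSymMinus : Subalgebra ℚ (MvPowerSeries ℕ+ ℚ) := Algebra.adjoin ℚ nonEscherFund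

/-- `F^cyc_{[L]}` as an element of `cQSym⁻`, for a non-Escher cyclic composition `[L]`. -/
def NonEscherComp.fund (L : NonEscherComp) : cQSymMinus :=
  ⟨fundCycQSymComp L.1, by
    obtain ⟨c, n, S, h, rfl⟩ := L
    exact Algebra.subset_adjoin ⟨n, S, h, (fundCycQSymComp_cComp h).2⟩⟩

/-! ## Cyclic permutation statistics and cyclic shuffle-compatibility -/

theorem finite_letters_subset (s : Finset ℕ+) : {τ : CyclicPerm | τ.letters ⊆ s}.Finite := by
  have h1 : Set.Finite {l : List ℕ+ | l.Nodup ∧ l.toFinset ⊆ s} := by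
    refine Set.Finite.subset (List.finite_toSet (s.powerset.toList.flatMap fun u =>
      u.toList.permutations)) ?_
    rintro l ⟨hl, hs⟩
    simp only [Set.mem_ofPred_eq, List.mem_flatMap, Finset.mem_toList, Finset.mem_powerset,
      List.mem_permutations]
    refine ⟨l.toFinset, hs, ?_⟩
    exact ((List.toFinset_toList hl).symm)
  refine Set.Finite.of_finite_image (f := Subtype.val)
    ((Set.Finite.image (fun l : List ℕ+ => (l : Cycle ℕ+)) h1).subset ?_)
    Subtype.val_injective.injOn
  rintro _ ⟨⟨c, hc⟩, h, rfl⟩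
  induction c using Quotient.inductionOn with
  | h l => exact ⟨l, ⟨hc, h⟩, rfl⟩

namespace CyclicPerm

theorem ind {P : CyclicPerm → Prop} (h : ∀ l hl, P (ofList l hl)) (π : CyclicPerm) : P π := by
  obtain ⟨c, hc⟩ := π
  induction c using Quotient.inductionOn with
  | h l => exact h l hc

theorem length_eq_card (π : CyclicPerm) : π.length = π.letters.card := by
  induction π using ind with
  | h l hl => exact (List.toFinset_card_of_nodup hl).symm

theorem isRotated_filter {l l' : List ℕ+} (s : Finset ℕ+) (h : l ~r l') :
    l.filter (· ∈ s) ~r l'.filter (· ∈ s) := by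
  refine Cycle.coe_eq_coe.1
    (eq_of_isRotated (fun l => ((l.filter (· ∈ s) : List ℕ+) : Cycle ℕ+)) (fun a l => ?_) h)
  by_cases ha : a ∈ s
  · simpa [List.filter_append, ha] using Cycle.coe_cons_eq_coe_append (l.filter (· ∈ s)) a
  · simp [List.filter_append, ha]

/-- The restriction of a cyclic permutation to its letters in `s`. -/
def restrict (τ : CyclicPerm) (s : Finset ℕ+) : CyclicPerm :=
  ⟨Quotient.map (List.filter (· ∈ s)) (by intro l l' h; exact isRotated_filter s h) τ.1, by
    obtain ⟨c, hc⟩ := τ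
    induction c using Quotient.inductionOn with
    | h l => exact List.Nodup.filter _ hc⟩

theorem ofList_restrict (l : List ℕ+) (hl : l.Nodup) (s : Finset ℕ+) :
    (ofList l hl).restrict s = ofList (l.filter (· ∈ s)) (hl.filter _) := rfl

theorem letters_ofList (l : List ℕ+) (hl : l.Nodup) : (ofList l hl).letters = l.toFinset := rfl

theorem letters_restrict (τ : CyclicPerm) (s : Finset ℕ+) :
    (τ.restrict s).letters = τ.letters ∩ s := by
  induction τ using ind with
  | h l hl => ext; simp [ofList_restrict, letters_ofList]

theorem ofList_eq {l l' : List ℕ+} {hl : l.Nodup} {hl' : l'.Nodup} :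
    ofList l hl = ofList l' hl' ↔ l ~r l' :=
  ⟨fun h => Cycle.coe_eq_coe.1 (congrArg Subtype.val h), fun h => Subtype.ext (Cycle.coe_eq_coe.2 h)⟩

theorem restrict_restrict (τ : CyclicPerm) (s t : Finset ℕ+) :
    (τ.restrict s).restrict t = τ.restrict (s ∩ t) := by
  induction τ using ind with
  | h l hl =>
    simp only [ofList_restrict, ofList_eq, List.filter_filter]
    rw [List.filter_congr (q := (· ∈ s ∩ t)) (fun x _ => by simp [Bool.and_comm])]

theorem restrict_eq_self (τ : CyclicPerm) (s : Finset ℕ+) (h : τ.letters ⊆ s) :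
    τ.restrict s = τ := by
  induction τ using ind with
  | h l hl =>
    rw [ofList_restrict, ofList_eq, List.filter_eq_self.2]
    intro a ha
    simpa using h (by simpa [letters_ofList] using ha)

end CyclicPerm

theorem filter_of_sublist {p t : List ℕ+} (ht : t.Nodup) (h : p.Sublist t) :
    t.filter (· ∈ p.toFinset) = p := by
  have h1 : p.Sublist (t.filter (· ∈ p.toFinset)) := by
    have := h.filter (· ∈ p.toFinset)
    rwa [List.filter_eq_self.2 (by simp)] at this
  refine (h1.eq_of_length_le ?_).symm
  rw [← List.toFinset_card_of_nodup (ht.filter _), ← List.toFinset_card_of_nodup (ht.sublist h)]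
  exact Finset.card_le_card fun x => by simp

/-- Cyclic shuffles through restrictions. -/
theorem isCyclicShuffle_iff (π σ τ : CyclicPerm) : IsCyclicShuffle π σ τ ↔
    Disjoint π.letters σ.letters ∧ τ.letters = π.letters ∪ σ.letters ∧
      τ.restrict π.letters = π ∧ τ.restrict σ.letters = σ := by
  constructor
  · rintro ⟨p, s, t, hp, hs, ht, hd, hn, hlen, h1, h2⟩
    have hpn := hn.sublist h1
    have hsn := hn.sublist h2
    obtain rfl : CyclicPerm.ofList p hpn = π := Subtype.ext hp
    obtain rfl : CyclicPerm.ofList s hsn = σ := Subtype.ext hs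
    obtain rfl : CyclicPerm.ofList t hn = τ := Subtype.ext ht
    simp only [CyclicPerm.letters_ofList, CyclicPerm.ofList_restrict,
      filter_of_sublist hn h1, filter_of_sublist hn h2]
    have hd' : Disjoint p.toFinset s.toFinset := List.disjoint_toFinset_iff_disjoint.2 hd
    refine ⟨hd', ?_, trivial, trivial⟩
    refine (Finset.eq_of_subset_of_card_le ?_ ?_).symm
    · intro x hx
      simp only [Finset.mem_union, List.mem_toFinset] at hx ⊢
      exact hx.elim (fun h => h1.subset h) (fun h => h2.subset h)
    · rw [Finset.card_union_of_disjoint hd', List.toFinset_card_of_nodup hn,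
        List.toFinset_card_of_nodup hpn, List.toFinset_card_of_nodup hsn, hlen]
  · rintro ⟨hd, hu, h1, h2⟩
    induction τ using CyclicPerm.ind with
    | h t ht =>
      refine ⟨t.filter (· ∈ π.letters), t.filter (· ∈ σ.letters), t, congrArg Subtype.val h1,
        congrArg Subtype.val h2, rfl, ?_, ht, ?_, List.filter_sublist, List.filter_sublist⟩
      · intro a ha hb
        exact Finset.disjoint_left.1 hd (by simpa using (List.mem_filter.1 ha).2)
          (by simpa using (List.mem_filter.1 hb).2)
      · have e1 := CyclicPerm.length_eq_card ((CyclicPerm.ofList t ht).restrict π.letters)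
        have e2 := CyclicPerm.length_eq_card ((CyclicPerm.ofList t ht).restrict σ.letters)
        have e3 := CyclicPerm.length_eq_card (CyclicPerm.ofList t ht)
        rw [h1] at e1
        rw [h2] at e2
        rw [hu, Finset.card_union_of_disjoint hd, ← e1, ← e2] at e3
        have e4 : (t.filter (· ∈ π.letters)).length = π.length := congrArg CyclicPerm.length h1
        have e5 : (t.filter (· ∈ σ.letters)).length = σ.length := congrArg CyclicPerm.length h2
        rw [e4, e5]
        exact e3

/-- The set `[π] ⧢ [σ]` of cyclic shuffles of `[π]` and `[σ]` (for disjoint `π`, `σ`). -/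
def cyclicShuffles (π σ : CyclicPerm) : Finset CyclicPerm :=
  Set.Finite.toFinset (s := {τ | IsCyclicShuffle π σ τ})
    ((finite_letters_subset (π.letters ∪ σ.letters)).subset fun τ h =>
      ((isCyclicShuffle_iff π σ τ).1 h).2.1.subset)

theorem mem_cyclicShuffles {π σ τ : CyclicPerm} :
    τ ∈ cyclicShuffles π σ ↔ IsCyclicShuffle π σ τ := by
  simp [cyclicShuffles]

theorem cyclicShuffles_comm (π σ : CyclicPerm) : cyclicShuffles π σ = cyclicShuffles σ π := by
  ext τ
  rw [mem_cyclicShuffles, mem_cyclicShuffles, isCyclicShuffle_iff, isCyclicShuffle_iff,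
    disjoint_comm, Finset.union_comm]
  tauto

/-- Iterated cyclic shuffles of three cyclic permutations. -/
theorem sum_cyclicShuffles_assoc {M : Type*} [AddCommMonoid M] (f : CyclicPerm → M)
    {π σ ρ : CyclicPerm} (h1 : Disjoint π.letters σ.letters) (h2 : Disjoint π.letters ρ.letters)
    (h3 : Disjoint σ.letters ρ.letters) :
    ∑ τ ∈ cyclicShuffles π σ, ∑ ω ∈ cyclicShuffles τ ρ, f ω =
      ∑ τ ∈ cyclicShuffles σ ρ, ∑ ω ∈ cyclicShuffles π τ, f ω := by
  classical
  rw [← Finset.sum_biUnion, ← Finset.sum_biUnion]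
  · refine Finset.sum_congr ?_ fun _ _ => rfl
    have key : ∀ ω : CyclicPerm, ω ∈ (cyclicShuffles π σ).biUnion (fun τ => cyclicShuffles τ ρ) ↔
        ω.letters = π.letters ∪ σ.letters ∪ ρ.letters ∧ ω.restrict π.letters = π ∧
          ω.restrict σ.letters = σ ∧ ω.restrict ρ.letters = ρ := by
      intro ω
      simp only [Finset.mem_biUnion, mem_cyclicShuffles, isCyclicShuffle_iff]
      constructor
      · rintro ⟨τ, ⟨-, a1, a2, a3⟩, -, b1, b2, b3⟩
        refine ⟨by rw [b1, a1], ?_, ?_, b3⟩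
        · rw [← b2, CyclicPerm.restrict_restrict] at a2
          rwa [Finset.inter_eq_right.2 (a1 ▸ Finset.subset_union_left)] at a2
        · rw [← b2, CyclicPerm.restrict_restrict] at a3
          rwa [Finset.inter_eq_right.2 (a1 ▸ Finset.subset_union_right)] at a3
      · rintro ⟨a, b, c, d⟩
        have hl : (ω.restrict (π.letters ∪ σ.letters)).letters = π.letters ∪ σ.letters := by
          rw [CyclicPerm.letters_restrict, a, Finset.inter_eq_right]
          exact Finset.subset_union_left
        refine ⟨ω.restrict (π.letters ∪ σ.letters), ⟨h1, hl, ?_, ?_⟩, ?_, ?_, ?_, d⟩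
        · rw [CyclicPerm.restrict_restrict, Finset.inter_eq_right.2 Finset.subset_union_left, b]
        · rw [CyclicPerm.restrict_restrict, Finset.inter_eq_right.2 Finset.subset_union_right, c]
        · rw [hl, Finset.disjoint_union_left]; exact ⟨h2, h3⟩
        · rw [hl, a]
        · rw [hl]
    have key' : ∀ ω : CyclicPerm, ω ∈ (cyclicShuffles σ ρ).biUnion (fun τ => cyclicShuffles π τ) ↔
        ω.letters = π.letters ∪ σ.letters ∪ ρ.letters ∧ ω.restrict π.letters = π ∧
          ω.restrict σ.letters = σ ∧ ω.restrict ρ.letters = ρ := by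
      intro ω
      simp only [Finset.mem_biUnion, mem_cyclicShuffles, isCyclicShuffle_iff]
      constructor
      · rintro ⟨τ, ⟨-, a1, a2, a3⟩, -, b1, b2, b3⟩
        refine ⟨by rw [b1, a1, Finset.union_assoc], b2, ?_, ?_⟩
        · rw [← b3, CyclicPerm.restrict_restrict] at a2
          rwa [Finset.inter_eq_right.2 (a1 ▸ Finset.subset_union_left)] at a2
        · rw [← b3, CyclicPerm.restrict_restrict] at a3
          rwa [Finset.inter_eq_right.2 (a1 ▸ Finset.subset_union_right)] at a3
      · rintro ⟨a, b, c, d⟩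
        have hl : (ω.restrict (σ.letters ∪ ρ.letters)).letters = σ.letters ∪ ρ.letters := by
          rw [CyclicPerm.letters_restrict, a, Finset.inter_eq_right, Finset.union_assoc]
          exact Finset.subset_union_right
        refine ⟨ω.restrict (σ.letters ∪ ρ.letters), ⟨h3, hl, ?_, ?_⟩, ?_, ?_, b, ?_⟩
        · rw [CyclicPerm.restrict_restrict, Finset.inter_eq_right.2 Finset.subset_union_left, c]
        · rw [CyclicPerm.restrict_restrict, Finset.inter_eq_right.2 Finset.subset_union_right, d]
        · rw [hl, Finset.disjoint_union_right]; exact ⟨h1, h2⟩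
        · rw [hl, a, Finset.union_assoc]
        · rw [hl]
    ext ω
    rw [key, key']
  · intro τ hτ τ' hτ' hne
    refine Finset.disjoint_left.2 fun ω h h' => hne ?_
    simp only [Finset.mem_coe, mem_cyclicShuffles, isCyclicShuffle_iff] at hτ hτ' h h'
    rw [← h.2.2.2, ← h'.2.2.2, hτ.2.1, hτ'.2.1]
  · intro τ hτ τ' hτ' hne
    refine Finset.disjoint_left.2 fun ω h h' => hne ?_
    simp only [Finset.mem_coe, mem_cyclicShuffles, isCyclicShuffle_iff] at hτ hτ' h h'
    rw [← h.2.2.1, ← h'.2.2.1, hτ.2.1, hτ'.2.1]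

/-- A cyclic permutation statistic: a function on cyclic permutations with `cst [π] = cst [σ]`
whenever `π` and `σ` have the same relative order. -/
structure CyclicStatistic (X : Type*) where
  /-- The value of the statistic. -/
  toFun : CyclicPerm → X
  /-- The value depends on the relative order only. -/
  relOrder : ∀ (p q : List ℕ+) (hp : p.Nodup) (hq : q.Nodup), SameRelOrder p q →
    toFun (CyclicPerm.ofList p hp) = toFun (CyclicPerm.ofList q hq)

namespace CyclicStatistic

variable {X : Type*}

instance : CoeFun (CyclicStatistic X) fun _ => CyclicPerm → X := ⟨toFun⟩

/-- `cst` is a cyclic descent statistic: it depends only on the cyclic descent composition. -/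
def IsDescent (cst : CyclicStatistic X) : Prop :=
  ∀ π σ : CyclicPerm, π.cComp = σ.cComp → cst π = cst σ

/-- `cst` is cyclic shuffle-compatible: the distribution (a multiset) of `cst` over the cyclic
shuffles of `[π]` and `[σ]`, for disjoint `π` and `σ`, depends only on `cst [π]`, `cst [σ]` and the
lengths of `π` and `σ`. -/
def ShuffleCompatible (cst : CyclicStatistic X) : Prop :=
  ∀ π σ π' σ' : CyclicPerm, Disjoint π.letters σ.letters → Disjoint π'.letters σ'.letters →
    cst π = cst π' → cst σ = cst σ' → π.length = π'.length → σ.length = σ'.length →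
    (cyclicShuffles π σ).val.map cst = (cyclicShuffles π' σ').val.map cst

/-- `cst`-equivalence of cyclic permutations: same value of `cst` and same length. -/
def permSetoid (cst : CyclicStatistic X) : Setoid CyclicPerm where
  r π σ := cst π = cst σ ∧ π.length = σ.length
  iseqv := ⟨fun _ => ⟨rfl, rfl⟩, fun h => ⟨h.1.symm, h.2.symm⟩,
    fun h h' => ⟨h.1.trans h'.1, h.2.trans h'.2⟩⟩

/-- The `cst`-equivalence classes of cyclic permutations. -/
def PermClass (cst : CyclicStatistic X) : Type := Quotient cst.permSetoid

/-- The `cst`-equivalence class `[π]_cst`. -/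
def permClass (cst : CyclicStatistic X) (π : CyclicPerm) : cst.PermClass :=
  Quotient.mk cst.permSetoid π

/-- The value of `cst` on a non-Escher cyclic composition `[L]`: its value on any cyclic permutation
with cyclic descent composition `[L]`. -/
def onComp (cst : CyclicStatistic X) (L : NonEscherComp) : X := cst (exists_cComp_eq L).choose

theorem onComp_nonEscherComp (cst : CyclicStatistic X) (h : cst.IsDescent) (π : CyclicPerm) :
    cst.onComp π.nonEscherComp = cst π :=
  h _ _ (exists_cComp_eq π.nonEscherComp).choose_spec

/-- `cst`-equivalence of non-Escher cyclic compositions: same value of `cst` and same size. -/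
def compSetoid (cst : CyclicStatistic X) : Setoid NonEscherComp where
  r L K := cst.onComp L = cst.onComp K ∧ cycSize L.1 = cycSize K.1
  iseqv := ⟨fun _ => ⟨rfl, rfl⟩, fun h => ⟨h.1.symm, h.2.symm⟩,
    fun h h' => ⟨h.1.trans h'.1, h.2.trans h'.2⟩⟩

/-- The `cst`-equivalence classes of non-Escher cyclic compositions. -/
def CompClass (cst : CyclicStatistic X) : Type := Quotient cst.compSetoid

/-- The `cst`-equivalence class of a non-Escher cyclic composition. -/
def compClass (cst : CyclicStatistic X) (L : NonEscherComp) : cst.CompClass :=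
  Quotient.mk cst.compSetoid L

/-! ### The cyclic shuffle algebra -/

theorem exists_rep_disjoint (cst : CyclicStatistic X) (a : cst.PermClass) (s : Finset ℕ+) :
    ∃ π : CyclicPerm, cst.permClass π = a ∧ Disjoint π.letters s := by
  obtain ⟨N, hN⟩ := s.exists_le
  induction a using Quotient.inductionOn with
  | h π =>
    induction π using CyclicPerm.ind with
    | h l hl =>
      have hinj : Function.Injective fun x : ℕ+ => x + N := add_left_injective N
      refine ⟨CyclicPerm.ofList (l.map fun x => x + N) (hl.map hinj), Quotient.sound ⟨?_, ?_⟩, ?_⟩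
      · refine cst.relOrder _ _ _ _ ⟨by simp, fun i j => by simp⟩
      · exact List.length_map _
      · rw [CyclicPerm.letters_ofList, Finset.disjoint_left]
        intro x hx hxs
        obtain ⟨y, -, rfl⟩ := List.mem_map.1 (List.mem_toFinset.1 hx)
        exact absurd (hN _ hxs) (not_le.2 (by simpa [add_comm] using PNat.lt_add_right N y))

theorem exists_disjoint_reps (cst : CyclicStatistic X) (a b : cst.PermClass) :
    ∃ p : CyclicPerm × CyclicPerm, cst.permClass p.1 = a ∧ cst.permClass p.2 = b ∧
      Disjoint p.1.letters p.2.letters := by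
  obtain ⟨σ, h1, -⟩ := cst.exists_rep_disjoint b ∅
  obtain ⟨π, h2, h3⟩ := cst.exists_rep_disjoint a σ.letters
  exact ⟨(π, σ), h2, h1, h3⟩

/-- The formal sum of the classes of all cyclic shuffles of `[π]` and `[σ]`. -/
def shuffleSum (cst : CyclicStatistic X) (π σ : CyclicPerm) : cst.PermClass →₀ ℚ :=
  ∑ τ ∈ cyclicShuffles π σ, Finsupp.single (cst.permClass τ) 1

/-- The product of two classes: the formal sum of the classes of all cyclic shuffles of disjoint
representatives. When `cst` is cyclic shuffle-compatible, the choice of the representatives does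
not matter. -/
def classMul (cst : CyclicStatistic X) (a b : cst.PermClass) : cst.PermClass →₀ ℚ :=
  cst.shuffleSum (cst.exists_disjoint_reps a b).choose.1 (cst.exists_disjoint_reps a b).choose.2

theorem shuffleSum_eq (cst : CyclicStatistic X) (hc : cst.ShuffleCompatible)
    {π σ π' σ' : CyclicPerm} (h : Disjoint π.letters σ.letters)
    (h' : Disjoint π'.letters σ'.letters) (h1 : cst.permClass π = cst.permClass π')
    (h2 : cst.permClass σ = cst.permClass σ') : cst.shuffleSum π σ = cst.shuffleSum π' σ' := by
  obtain ⟨a1, a2⟩ := Quotient.exact h1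
  obtain ⟨b1, b2⟩ := Quotient.exact h2
  have hm := hc π σ π' σ' h h' a1 b1 a2 b2
  rw [← Multiset.rel_eq, Multiset.rel_map] at hm
  have hlen : ∀ {π σ τ : CyclicPerm}, τ ∈ cyclicShuffles π σ →
      τ.length = π.length + σ.length := by
    intro π σ τ h
    rw [mem_cyclicShuffles, isCyclicShuffle_iff] at h
    rw [CyclicPerm.length_eq_card, h.2.1, Finset.card_union_of_disjoint h.1,
      CyclicPerm.length_eq_card, CyclicPerm.length_eq_card]
  have hm2 : (cyclicShuffles π σ).val.map cst.permClass =
      (cyclicShuffles π' σ').val.map cst.permClass := by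
    rw [← Multiset.rel_eq, Multiset.rel_map]
    refine hm.mono fun τ hτ τ' hτ' hh => Quotient.sound ⟨hh, ?_⟩
    rw [hlen hτ, hlen hτ', a2, b2]
  have hm3 := congrArg
    (fun m => (Multiset.map (fun a => (Finsupp.single a 1 : cst.PermClass →₀ ℚ)) m).sum) hm2
  rw [Multiset.map_map, Multiset.map_map] at hm3
  exact hm3

theorem classMul_permClass (cst : CyclicStatistic X) (hc : cst.ShuffleCompatible)
    {π σ : CyclicPerm} (h : Disjoint π.letters σ.letters) :
    cst.classMul (cst.permClass π) (cst.permClass σ) = cst.shuffleSum π σ := by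
  obtain ⟨h1, h2, h3⟩ := (cst.exists_disjoint_reps (cst.permClass π) (cst.permClass σ)).choose_spec
  exact cst.shuffleSum_eq hc h3 h h1 h2

/-- The bilinear extension of `classMul`. -/
def mulMap (cst : CyclicStatistic X) :
    (cst.PermClass →₀ ℚ) →ₗ[ℚ] (cst.PermClass →₀ ℚ) →ₗ[ℚ] (cst.PermClass →₀ ℚ) :=
  Finsupp.linearCombination ℚ fun a => Finsupp.linearCombination ℚ fun b => cst.classMul a b

theorem mulMap_single (cst : CyclicStatistic X) (a b : cst.PermClass) :
    cst.mulMap (Finsupp.single a 1) (Finsupp.single b 1) = cst.classMul a b := by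
  simp [mulMap]

/-- The cyclic shuffle algebra of a cyclic shuffle-compatible statistic `cst`: the `ℚ`-vector space
with basis the `cst`-equivalence classes of cyclic permutations. -/
def ShuffleAlgebra (cst : CyclicStatistic X) (_hc : cst.ShuffleCompatible) : Type :=
  cst.PermClass →₀ ℚ

namespace ShuffleAlgebra

variable {cst : CyclicStatistic X} {hc : cst.ShuffleCompatible}

instance : AddCommGroup (cst.ShuffleAlgebra hc) :=
  inferInstanceAs (AddCommGroup (cst.PermClass →₀ ℚ))

instance : Module ℚ (cst.ShuffleAlgebra hc) := inferInstanceAs (Module ℚ (cst.PermClass →₀ ℚ))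

/-- The basis element `[π]_cst` of the cyclic shuffle algebra. -/
def of (hc : cst.ShuffleCompatible) (π : CyclicPerm) : cst.ShuffleAlgebra hc :=
  (Finsupp.single (cst.permClass π) 1 : cst.PermClass →₀ ℚ)

instance : Mul (cst.ShuffleAlgebra hc) := ⟨fun x y => cst.mulMap x y⟩

/-- The empty cyclic permutation. -/
def emptyPerm : CyclicPerm := CyclicPerm.ofList [] List.nodup_nil

instance : One (cst.ShuffleAlgebra hc) := ⟨of hc emptyPerm⟩

theorem one_def : (1 : cst.ShuffleAlgebra hc) = of hc emptyPerm := rfl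

theorem mul_def (x y : cst.ShuffleAlgebra hc) :
    x * y = (cst.mulMap x y : cst.PermClass →₀ ℚ) := rfl

/-- The multiplication of the cyclic shuffle algebra:
`[π]_cst [σ]_cst = ∑ [τ]_cst` over all `[τ]` in `[π] ⧢ [σ]`, for all disjoint `π` and `σ`. -/
theorem of_mul_of {π σ : CyclicPerm} (h : Disjoint π.letters σ.letters) :
    of hc π * of hc σ = ∑ τ ∈ cyclicShuffles π σ, of hc τ := by
  change cst.mulMap (Finsupp.single _ 1) (Finsupp.single _ 1) = cst.shuffleSum π σ
  rw [mulMap_single, cst.classMul_permClass hc h]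

theorem add_mul' (x y z : cst.ShuffleAlgebra hc) : (x + y) * z = x * z + y * z :=
  LinearMap.map_add₂ cst.mulMap x y z

theorem mul_add' (x y z : cst.ShuffleAlgebra hc) : x * (y + z) = x * y + x * z :=
  map_add (cst.mulMap x) y z

theorem smul_mul' (r : ℚ) (x y : cst.ShuffleAlgebra hc) : (r • x) * y = r • (x * y) :=
  LinearMap.map_smul₂ cst.mulMap r x y

theorem mul_smul' (r : ℚ) (x y : cst.ShuffleAlgebra hc) : x * (r • y) = r • (x * y) :=
  map_smul (cst.mulMap x) r y

theorem zero_mul' (x : cst.ShuffleAlgebra hc) : 0 * x = 0 := LinearMap.map_zero₂ cst.mulMap x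

theorem mul_zero' (x : cst.ShuffleAlgebra hc) : x * 0 = 0 := map_zero (cst.mulMap x)

theorem sum_mul' {ι : Type*} (s : Finset ι) (f : ι → cst.ShuffleAlgebra hc)
    (x : cst.ShuffleAlgebra hc) : (∑ i ∈ s, f i) * x = ∑ i ∈ s, f i * x :=
  LinearMap.map_sum₂ cst.mulMap s f x

theorem mul_sum' {ι : Type*} (s : Finset ι) (f : ι → cst.ShuffleAlgebra hc)
    (x : cst.ShuffleAlgebra hc) : x * (∑ i ∈ s, f i) = ∑ i ∈ s, x * f i :=
  map_sum (cst.mulMap x) f s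

/-- Induction: the elements `[π]_cst`, with letters of `π` outside a given finite set, span. -/
theorem induction {P : cst.ShuffleAlgebra hc → Prop} (s : Finset ℕ+)
    (h0 : P 0) (hadd : ∀ x y, P x → P y → P (x + y)) (hsmul : ∀ (r : ℚ) x, P x → P (r • x))
    (hof : ∀ π : CyclicPerm, Disjoint π.letters s → P (of hc π)) (x : cst.ShuffleAlgebra hc) :
    P x := by
  refine Finsupp.induction_linear (motive := P) x h0 hadd fun a r => ?_
  obtain ⟨π, rfl, hd⟩ := cst.exists_rep_disjoint a s
  have h := hsmul r _ (hof π hd)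
  have e : (Finsupp.single (cst.permClass π) r : cst.PermClass →₀ ℚ) =
      r • Finsupp.single (cst.permClass π) 1 := by simp
  rw [e]
  exact h

theorem mul_comm' (x y : cst.ShuffleAlgebra hc) : x * y = y * x := by
  induction x using induction ∅ with
  | h0 => rw [zero_mul', mul_zero']
  | hadd a b ha hb => rw [add_mul', mul_add', ha, hb]
  | hsmul r a ha => rw [smul_mul', mul_smul', ha]
  | hof π =>
    induction y using induction π.letters with
    | h0 => rw [zero_mul', mul_zero']
    | hadd a b ha hb => rw [add_mul', mul_add', ha, hb]
    | hsmul r a ha => rw [smul_mul', mul_smul', ha]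
    | hof σ hσ => rw [of_mul_of hσ, of_mul_of hσ.symm, cyclicShuffles_comm]

theorem mul_assoc' (x y z : cst.ShuffleAlgebra hc) : x * y * z = x * (y * z) := by
  induction x using induction ∅ with
  | h0 => simp only [zero_mul']
  | hadd a b ha hb => simp only [add_mul', ha, hb]
  | hsmul r a ha => simp only [smul_mul', ha]
  | hof π =>
    induction y using induction π.letters with
    | h0 => simp only [zero_mul', mul_zero']
    | hadd a b ha hb => simp only [add_mul', mul_add', ha, hb]
    | hsmul r a ha => simp only [smul_mul', mul_smul', ha]
    | hof σ hσ =>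
      induction z using induction (π.letters ∪ σ.letters) with
      | h0 => simp only [mul_zero']
      | hadd a b ha hb => simp only [mul_add', ha, hb]
      | hsmul r a ha => simp only [mul_smul', ha]
      | hof ρ hρ =>
        obtain ⟨h1, h2⟩ := Finset.disjoint_union_right.1 hρ
        rw [of_mul_of hσ.symm, of_mul_of h2.symm, sum_mul', mul_sum']
        have e1 : ∀ τ ∈ cyclicShuffles π σ,
            of hc τ * of hc ρ = ∑ ω ∈ cyclicShuffles τ ρ, of hc ω := fun τ hτ => by
          rw [mem_cyclicShuffles, isCyclicShuffle_iff] at hτ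
          exact of_mul_of (hτ.2.1 ▸ hρ.symm)
        have e2 : ∀ τ ∈ cyclicShuffles σ ρ,
            of hc π * of hc τ = ∑ ω ∈ cyclicShuffles π τ, of hc ω := fun τ hτ => by
          rw [mem_cyclicShuffles, isCyclicShuffle_iff] at hτ
          exact of_mul_of (hτ.2.1 ▸ Finset.disjoint_union_right.2 ⟨hσ.symm, h1.symm⟩)
        rw [Finset.sum_congr rfl e1, Finset.sum_congr rfl e2]
        exact sum_cyclicShuffles_assoc _ hσ.symm h1.symm h2.symm

theorem one_mul' (x : cst.ShuffleAlgebra hc) : 1 * x = x := by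
  induction x using induction ∅ with
  | h0 => simp only [mul_zero']
  | hadd a b ha hb => simp only [mul_add', ha, hb]
  | hsmul r a ha => simp only [mul_smul', ha]
  | hof π =>
    have he : emptyPerm.letters = ∅ := rfl
    rw [one_def, of_mul_of (by rw [he]; exact Finset.disjoint_empty_left _)]
    have : cyclicShuffles emptyPerm π = {π} := by
      ext τ
      rw [mem_cyclicShuffles, isCyclicShuffle_iff, Finset.mem_singleton, he]
      constructor
      · rintro ⟨-, h1, -, h2⟩
        rw [← h2, CyclicPerm.restrict_eq_self _ _ (by rw [h1, Finset.empty_union])]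
      · rintro rfl
        refine ⟨Finset.disjoint_empty_left _, by simp, ?_, CyclicPerm.restrict_eq_self _ _ le_rfl⟩
        induction τ using CyclicPerm.ind with
        | h l hl =>
          rw [CyclicPerm.ofList_restrict, emptyPerm, CyclicPerm.ofList_eq]
          simp
    rw [this, Finset.sum_singleton]

instance : CommRing (cst.ShuffleAlgebra hc) where
  __ := (inferInstance : AddCommGroup (cst.ShuffleAlgebra hc))
  left_distrib := mul_add'
  right_distrib := add_mul'
  zero_mul := zero_mul'
  mul_zero := mul_zero'
  mul_assoc := mul_assoc'
  one_mul := one_mul'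
  mul_one x := by rw [mul_comm', one_mul']
  mul_comm := mul_comm'

instance : Algebra ℚ (cst.ShuffleAlgebra hc) :=
  Algebra.ofModule smul_mul' fun r x y => mul_smul' r x y

end ShuffleAlgebra

end CyclicStatistic

end CyclicShuffle

end

open CyclicShuffle

/-! Everything rests on one product formula: if π and σ share no letter, the product of their
fundamental cyclic functions is the sum of those of all cyclic shuffles of [π] and [σ]
(`fundCycQSymComp_mul`). It is proved by counting, as for P-partitions. Label letters by positive
integers and sort them by label, ties by letter. A weakly increasing index sequence that is strict
at the descents of `l` is the same as a labeling that sorts the letters into `l` (`fundQSym_apply`).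
The shifts of cDes π are the cyclic descent sets of the rotations of π, so a coefficient of F^cyc
counts the labelings that sort the letters into any representative of [π] (`fundCycQSymComp_apply`).
A labeling of a disjoint union of alphabets is a pair of labelings, and its sorted cyclic word
restricts to the two smaller sorted cyclic words: it is one of their cyclic shuffles.

Any two non-Escher cyclic compositions are realized on disjoint alphabets, so the span of the F^cyc
is closed under multiplication. The F^cyc are also linearly independent, by triangularity in the
number of parts (`linearIndependent_fundCycQSymComp`), so a linear map on cQSym⁻ may be prescribed
on them.

If cst is shuffle-compatible, sending F^cyc_{[L]} to the class of any [π] with cComp[π] = [L] is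
multiplicative, because both products are the same sum over shuffles. Conversely, a homomorphism to
A carries the product formula to the basis v; uniqueness of coordinates then shows that the
distribution of classes over the shuffles depends only on the two factor classes. The same formula
makes [π]_cst ↦ v_α multiplicative, and the kernel of the surjection from cQSym⁻ gives the quotient.
-/

noncomputable section

namespace CyclicShuffle

/-! ## Sorting letters by labels -/

/-- The order on letters by the label `h`, where equal labels are ordered by the letters. -/
def LabelLE (h : ℕ+ → ℕ+) (a b : ℕ+) : Prop := h a < h b ∨ h a = h b ∧ a ≤ b

instance (h : ℕ+ → ℕ+) : DecidableRel (LabelLE h) := fun a b =>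
  inferInstanceAs (Decidable (h a < h b ∨ h a = h b ∧ a ≤ b))

theorem labelLE_iff (h : ℕ+ → ℕ+) (a b : ℕ+) :
    LabelLE h a b ↔ toLex (h a, a) ≤ toLex (h b, b) := by
  rw [Prod.Lex.le_iff]; rfl

instance (h : ℕ+ → ℕ+) : IsTrans ℕ+ (LabelLE h) where
  trans a b c := by simp only [labelLE_iff]; exact le_trans

instance (h : ℕ+ → ℕ+) : Std.Antisymm (LabelLE h) where
  antisymm a b h1 h2 := by
    rw [labelLE_iff] at h1 h2
    exact congrArg (fun x => (ofLex x).2) (le_antisymm h1 h2)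

instance (h : ℕ+ → ℕ+) : Std.Total (LabelLE h) where
  total a b := by simp only [labelLE_iff]; exact le_total _ _

/-- The letters in `s`, sorted by their labels. -/
def sortBy (h : ℕ+ → ℕ+) (s : Finset ℕ+) : List ℕ+ := s.sort (LabelLE h)

theorem nodup_sortBy (h : ℕ+ → ℕ+) (s : Finset ℕ+) : (sortBy h s).Nodup := s.sort_nodup _

theorem toFinset_sortBy (h : ℕ+ → ℕ+) (s : Finset ℕ+) : (sortBy h s).toFinset = s :=
  s.sort_toFinset _

theorem sortBy_toFinset {h : ℕ+ → ℕ+} {l : List ℕ+} (hl : l.Nodup) :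
    sortBy h l.toFinset = l ↔ l.Pairwise (LabelLE h) := List.toFinset_sort _ hl

/-- A sublist of a sorted list is sorted, and a sorted list is determined by its letters. This is
what turns sorting a union of alphabets into a shuffle. -/
theorem filter_sortBy (h : ℕ+ → ℕ+) {s t : Finset ℕ+} (hst : t ⊆ s) :
    (sortBy h s).filter (· ∈ t) = sortBy h t := by
  have h1 : ((sortBy h s).filter (· ∈ t)).toFinset = t := by
    rw [List.toFinset_filter, toFinset_sortBy]
    ext a
    simpa using fun ha => hst ha
  conv_rhs => rw [← h1]
  exact ((sortBy_toFinset ((nodup_sortBy h s).filter _)).2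
    ((s.pairwise_sort (LabelLE h)).filter _)).symm

theorem sortBy_congr {h h' : ℕ+ → ℕ+} {s : Finset ℕ+} (hh : ∀ a ∈ s, h a = h' a) :
    sortBy h s = sortBy h' s := by
  have := (sortBy_toFinset (h := h) (nodup_sortBy h' s)).2 (by
    refine (s.pairwise_sort (LabelLE h')).imp_of_mem fun {a b} ha hb hab => ?_
    rw [sortBy, Finset.mem_sort] at ha hb
    rwa [LabelLE, hh a ha, hh b hb])
  rwa [toFinset_sortBy] at this

/-- The cyclic permutation of the letters in `s`, sorted by their labels. -/
def sortCyc (h : ℕ+ → ℕ+) (s : Finset ℕ+) : CyclicPerm :=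
  CyclicPerm.ofList (sortBy h s) (nodup_sortBy h s)

theorem letters_sortCyc (h : ℕ+ → ℕ+) (s : Finset ℕ+) : (sortCyc h s).letters = s :=
  toFinset_sortBy h s

theorem restrict_sortCyc (h : ℕ+ → ℕ+) {s t : Finset ℕ+} (hst : t ⊆ s) :
    (sortCyc h s).restrict t = sortCyc h t :=
  (CyclicPerm.ofList_eq (hl := (nodup_sortBy h s).filter _)).2 (by rw [filter_sortBy h hst])

theorem sortCyc_congr {h h' : ℕ+ → ℕ+} {s : Finset ℕ+} (hh : ∀ a ∈ s, h a = h' a) :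
    sortCyc h s = sortCyc h' s := CyclicPerm.ofList_eq.2 (by rw [sortBy_congr hh])

/-! ## Labelings and their contents -/

/-- The content of the labeling `h` of the letters in `s`. -/
def content (h : ℕ+ → ℕ+) (s : Finset ℕ+) : ℕ+ →₀ ℕ := ∑ a ∈ s, Finsupp.single (h a) 1

theorem content_congr {h h' : ℕ+ → ℕ+} {s : Finset ℕ+} (hh : ∀ a ∈ s, h a = h' a) :
    content h s = content h' s := Finset.sum_congr rfl fun a ha => by rw [hh a ha]

theorem content_union (h : ℕ+ → ℕ+) {s t : Finset ℕ+} (hst : Disjoint s t) :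
    content h (s ∪ t) = content h s + content h t := Finset.sum_union hst

/-- On `s` the labels lie in the finite support of `d`; outside of `s` they are pinned to 1, so that
a labeling is determined by its values on `s`. -/
theorem finite_labelings (s : Finset ℕ+) (d : ℕ+ →₀ ℕ) :
    {h : ℕ+ → ℕ+ | (∀ a ∉ s, h a = 1) ∧ content h s = d}.Finite := by
  have h1 : {f : s → ℕ+ | ∀ a, f a ∈ (d.support : Set ℕ+)}.Finite :=
    Set.Finite.pi' fun _ => d.support.finite_toSet
  refine Set.Finite.of_finite_image (f := fun h (a : s) => h a) (h1.subset ?_) ?_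
  · rintro _ ⟨h, ⟨-, rfl⟩, rfl⟩ a
    simp only [content, Finset.mem_coe, Finsupp.mem_support_iff, Finsupp.coe_finsetSum,
      Finset.sum_apply]
    exact (Finset.sum_pos' (fun _ _ => Nat.zero_le _) ⟨a.1, a.2, by simp⟩).ne'
  · rintro h ⟨hh, -⟩ h' ⟨hh', -⟩ e
    funext a
    by_cases ha : a ∈ s
    · exact congrFun e ⟨a, ha⟩
    · rw [hh a ha, hh' a ha]

/-- The labelings of the letters in `s` with content `d` (with label `1` outside of `s`). -/
def labelings (s : Finset ℕ+) (d : ℕ+ →₀ ℕ) : Finset (ℕ+ → ℕ+) := (finite_labelings s d).toFinset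

theorem mem_labelings {s : Finset ℕ+} {d : ℕ+ →₀ ℕ} {h : ℕ+ → ℕ+} :
    h ∈ labelings s d ↔ (∀ a ∉ s, h a = 1) ∧ content h s = d := by simp [labelings]

/-- The tie rule of `LabelLE` encodes the strictness condition: neighbours with equal labels must
increase as letters, so at a descent the label has to jump. -/
theorem monotone_and_iff_pairwise {l : List ℕ+} (h : ℕ+ → ℕ+) :
    (Monotone (fun j : Fin l.length => h (l.get j)) ∧
      ∀ j k : Fin l.length, k.1 = j.1 + 1 → k.1 ∈ cDes l ∩ Finset.Icc 1 (l.length - 1) →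
        h (l.get j) < h (l.get k)) ↔ l.Pairwise (LabelLE h) := by
  -- The descent index `k`, counted from 1, compares the entries at positions `k - 1` and `k`,
  -- counted from 0. Intersecting with [n-1] removes only the wrap-around index n.
  have hdes : ∀ j k : Fin l.length, k.1 = j.1 + 1 →
      (k.1 ∈ cDes l ∩ Finset.Icc 1 (l.length - 1) ↔ l.get k < l.get j) := by
    intro j k hjk
    have hk := k.2
    have e : k.1 - 1 = j.1 := by omega
    simp only [cDes, Finset.mem_inter, Finset.mem_filter, Finset.mem_Icc, Nat.mod_eq_of_lt hk, e]
    rw [List.getD_eq_getElem _ _ hk, List.getD_eq_getElem _ _ j.2]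
    constructor
    · exact fun h => h.1.2
    · exact fun h => ⟨⟨⟨by omega, by omega⟩, h⟩, by omega, by omega⟩
  constructor
  · rintro ⟨h1, h2⟩
    -- By transitivity it suffices to compare neighbours.
    have : Trans (LabelLE h) (LabelLE h) (LabelLE h) := ⟨fun {a b c} => trans_of (LabelLE h)⟩
    rw [← List.isChain_iff_pairwise, List.isChain_iff_getElem]
    intro i hi
    have h3 : h l[i] ≤ h l[i + 1] :=
      h1 (a := ⟨i, by omega⟩) (b := ⟨i + 1, hi⟩) (by simp [Fin.le_def])
    rcases lt_or_ge l[i + 1] l[i] with h4 | h4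
    · exact Or.inl (h2 ⟨i, by omega⟩ ⟨i + 1, hi⟩ rfl ((hdes _ _ rfl).2 h4))
    · rcases h3.lt_or_eq with h5 | h5
      · exact Or.inl h5
      · exact Or.inr ⟨h5, h4⟩
  · intro hp
    have hp' := List.pairwise_iff_get.1 hp
    refine ⟨monotone_iff_forall_lt.2 fun i j hij => ?_, fun j k hjk hk => ?_⟩
    · exact (hp' i j hij).elim le_of_lt fun h => h.1.le
    · rw [hdes j k hjk] at hk
      exact (hp' j k (by rw [Fin.lt_def]; omega)).elim id fun h => absurd h.2 (not_le.2 hk)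

theorem sum_get_eq_content {l : List ℕ+} (hl : l.Nodup) (h : ℕ+ → ℕ+) :
    ∑ j : Fin l.length, Finsupp.single (h (l.get j)) 1 = content h l.toFinset := by
  rw [content, List.sum_toFinset _ hl, ← List.sum_ofFn]
  congr 1
  exact List.ext_get (by simp) fun n h1 h2 => by simp

/-- Functions that are `1` outside of the list `l`, by their values on `l`. -/
def valuesEquiv (l : List ℕ+) (hl : l.Nodup) :
    {h : ℕ+ → ℕ+ // ∀ a ∉ l, h a = 1} ≃ (Fin l.length → ℕ+) where
  toFun h j := h.1 (l.get j)
  invFun f := ⟨fun a => if ha : a ∈ l then f ⟨l.idxOf a, List.idxOf_lt_length_of_mem ha⟩ else 1,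
    fun a ha => dif_neg ha⟩
  left_inv h := by
    ext a
    by_cases ha : a ∈ l
    · simp [ha]
    · simp [ha, h.2 a ha]
  right_inv f := by
    ext j
    simp [hl.idxOf_getElem]

/-- The coefficients of the fundamental quasisymmetric function of a linear permutation `l` count
the labelings that sort its letters into `l`. -/
theorem fundQSym_apply {l : List ℕ+} (hl : l.Nodup) (d : ℕ+ →₀ ℕ) :
    fundQSym l.length (cDes l ∩ Finset.Icc 1 (l.length - 1)) d =
      ((labelings l.toFinset d).filter fun h => sortBy h l.toFinset = l).card := by
  rw [fundQSym, Nat.cast_inj]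
  rw [← Nat.subtype_card (p := fun h : ℕ+ → ℕ+ => (∀ a ∉ l, h a = 1) ∧
    (content h l.toFinset = d ∧ sortBy h l.toFinset = l)) _ (by simp [mem_labelings, and_assoc])]
  refine Nat.card_congr (Equiv.trans (Equiv.symm ?_)
    (Equiv.subtypeSubtypeEquivSubtypeInter _ _))
  refine (valuesEquiv l hl).subtypeEquiv fun h => ?_
  rw [sortBy_toFinset hl, ← monotone_and_iff_pairwise, ← sum_get_eq_content hl]
  exact ⟨fun ⟨a, b, c⟩ => ⟨b, c, a⟩, fun ⟨b, c, a⟩ => ⟨a, b, c⟩⟩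

/-! ## Cyclic fundamental functions count labelings -/

theorem cycShift_cycShift {n : ℕ} {S : Finset ℕ} (hS : S ⊆ Finset.Icc 1 n) (a b : ℕ) :
    cycShift n (cycShift n S a) b = cycShift n S (a + b) := by
  rw [cycShift, cycShift, cycShift, Finset.image_image]
  refine Finset.image_congr fun s hs => ?_
  have := (Finset.mem_Icc.1 (hS hs)).1
  change ((s + a - 1) % n + 1 + b - 1) % n + 1 = (s + (a + b) - 1) % n + 1
  rw [show (s + a - 1) % n + 1 + b - 1 = (s + a - 1) % n + b by omega,
    show s + (a + b) - 1 = (s + a - 1) + b by omega, Nat.mod_add_mod]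

theorem cycShift_zero {n : ℕ} {S : Finset ℕ} (hS : S ⊆ Finset.Icc 1 n) : cycShift n S 0 = S := by
  rw [cycShift]
  conv_rhs => rw [← Finset.image_id (s := S)]
  refine Finset.image_congr fun s hs => ?_
  have := Finset.mem_Icc.1 (hS hs)
  change (s + 0 - 1) % n + 1 = s
  rw [Nat.mod_eq_of_lt (by omega)]
  omega

/-- Moving the first letter to the end lowers every cyclic descent by one modulo n, so shifting by
`i` undoes `i` rotations. -/
theorem cDes_eq_cycShift_rotate (l : List ℕ+) (i : ℕ) :
    cDes l = cycShift l.length (cDes (l.rotate i)) i := by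
  induction i with
  | zero => rw [List.rotate_zero, cycShift_zero (cDes_subset l)]
  | succ i ih =>
    have h1 : cDes (l.rotate i) = cycShift l.length (cDes (l.rotate (i + 1))) 1 := by
      rw [← List.rotate_rotate]
      have hlen := List.length_rotate l i
      generalize l.rotate i = m at hlen
      rw [← hlen]
      rcases m with _ | ⟨a, m⟩
      · simp [cDes, cycShift]
      · simpa using cDes_cons a m
    have h2 : cDes (l.rotate (i + 1)) ⊆ Finset.Icc 1 l.length := by
      simpa using cDes_subset (l.rotate (i + 1))
    rw [ih, h1, cycShift_cycShift h2, add_comm]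

open Classical in
/-- The coefficients of the fundamental cyclic quasisymmetric function of a cyclic permutation `π`
count the labelings that sort its letters into a representative of `π`. -/
theorem fundCycQSymComp_apply (π : CyclicPerm) (d : ℕ+ →₀ ℕ) :
    fundCycQSymComp π.cComp d =
      ((labelings π.letters d).filter fun h => sortCyc h π.letters = π).card := by
  induction π using CyclicPerm.ind with
  | h l hl =>
    have e : fundCycQSymComp (CyclicPerm.ofList l hl).cComp = fundCycQSym l.length (cDes l) :=
      (fundCycQSymComp_cComp ⟨l, hl, rfl, rfl⟩).2
    rw [e, CyclicPerm.letters_ofList]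
    -- The empty word is separate because `fundCycQSym 0` is set to 1 instead of being a sum over
    -- shifts; it agrees with the count of the single empty sequence.
    rcases Nat.eq_zero_or_pos l.length with h0 | hpos
    · obtain rfl := List.length_eq_zero_iff.1 h0
      have h1 := fundQSym_apply (l := []) List.nodup_nil d
      have h2 : ∀ h, sortCyc h (([] : List ℕ+).toFinset) = CyclicPerm.ofList [] hl := fun h => by
        rw [sortCyc, CyclicPerm.ofList_eq]; simp [sortBy]
      have h3 : ∀ h, sortBy h (([] : List ℕ+).toFinset) = [] := fun h => by simp [sortBy]
      simp only [h2, h3] at h1 ⊢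
      rw [← h1]
      simp only [fundCycQSym, List.length_nil, if_true, fundQSym]
      change MvPowerSeries.coeff d 1 = _
      rw [MvPowerSeries.coeff_one]
      by_cases hd : d = 0
      · subst hd
        simp [Subsingleton.monotone]
      · rw [if_neg hd]
        simp [Ne.symm hd]
    · have hne : l ≠ [] := List.ne_nil_of_length_pos hpos
      rw [fundCycQSym, if_neg hpos.ne']
      change MvPowerSeries.coeff d (∑ i ∈ Finset.Icc 1 l.length,
        fundQSym l.length (cycShift l.length (cDes l) i ∩ Finset.Icc 1 (l.length - 1))) = _
      rw [map_sum]
      -- The shift of cDes by `i` is the cyclic descent set of the rotation by `n - i`, so the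
      -- `i`-th summand counts the labelings that sort into this one representative.
      have key : ∀ i ∈ Finset.Icc 1 l.length,
          MvPowerSeries.coeff d
            (fundQSym l.length (cycShift l.length (cDes l) i ∩ Finset.Icc 1 (l.length - 1))) =
          (((labelings l.toFinset d).filter fun h =>
            sortCyc h l.toFinset = CyclicPerm.ofList l hl).filter
              fun h => sortBy h l.toFinset = l.rotate (l.length - i)).card := by
        intro i hi
        have hi' := Finset.mem_Icc.1 hi
        have h1 := cDes_eq_cycShift_rotate (l.rotate (l.length - i)) i
        rw [List.rotate_rotate, List.length_rotate, Nat.sub_add_cancel hi'.2,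
          List.rotate_length] at h1
        have h2 := fundQSym_apply (List.nodup_rotate.2 hl : (l.rotate (l.length - i)).Nodup) d
        have h3 : (l.rotate (l.length - i)).toFinset = l.toFinset := by ext; simp
        rw [h1, List.length_rotate, h3] at h2
        refine h2.trans ?_
        rw [Finset.filter_filter]
        congr 2
        refine Finset.filter_congr fun h _ => ⟨fun hh => ⟨?_, hh⟩, fun hh => hh.2⟩
        rw [sortCyc, CyclicPerm.ofList_eq, hh]
        exact List.IsRotated.symm ⟨_, rfl⟩
      rw [Finset.sum_congr rfl key, ← Nat.cast_sum, Nat.cast_inj, ← Finset.card_biUnion]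
      · congr 1
        ext h
        simp only [Finset.mem_biUnion, Finset.mem_filter]
        constructor
        · rintro ⟨i, hi, hh, -⟩
          exact hh
        · intro hh
          obtain ⟨m, hm⟩ := (CyclicPerm.ofList_eq.1 hh.2).symm
          have hlt := Nat.mod_lt m hpos
          -- The amount of rotation matters only modulo n; reducing it places the index in [1, n].
          refine ⟨l.length - m % l.length, by rw [Finset.mem_Icc]; omega, hh, ?_⟩
          rw [Nat.sub_sub_self hlt.le, List.rotate_mod, hm]
      -- The letters are distinct, so the n rotations of `l` are pairwise different and no labeling
      -- is counted twice.
      · intro i hi j hj hij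
        rw [Finset.mem_coe, Finset.mem_Icc] at hi hj
        rw [Function.onFun, Finset.disjoint_left]
        intro h h1 h2
        have h3 := (Finset.mem_filter.1 h1).2.symm.trans (Finset.mem_filter.1 h2).2
        have h4 := hl.rotate_congr hne _ _ h3
        rw [Nat.mod_eq_of_lt (by omega), Nat.mod_eq_of_lt (by omega)] at h4
        omega

open Classical in
/-- The product formula for fundamental cyclic quasisymmetric functions. -/
theorem fundCycQSymComp_mul {π σ : CyclicPerm} (hd : Disjoint π.letters σ.letters) :
    fundCycQSymComp π.cComp * fundCycQSymComp σ.cComp =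
      ∑ τ ∈ cyclicShuffles π σ, fundCycQSymComp τ.cComp := by
  ext d
  set s := π.letters with hs
  set t := σ.letters with ht
  have hst : ∀ {a}, a ∈ t → a ∉ s := fun ha hb => Finset.disjoint_left.1 hd hb ha
  -- Both sides count `H`: the sum over shuffles by the cyclic word into which all letters are
  -- sorted, the product by the pair of contents on `s` and `t`.
  let H := (labelings (s ∪ t) d).filter fun h => sortCyc h s = π ∧ sortCyc h t = σ
  have hR : MvPowerSeries.coeff d (∑ τ ∈ cyclicShuffles π σ, fundCycQSymComp τ.cComp) =
      (H.card : ℚ) := by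
    rw [map_sum]
    have hmaps : Set.MapsTo (fun h => sortCyc h (s ∪ t)) H (cyclicShuffles π σ) := by
      intro h hh
      obtain ⟨-, h1, h2⟩ := Finset.mem_filter.1 hh
      rw [Finset.mem_coe, mem_cyclicShuffles, isCyclicShuffle_iff, ← hs, ← ht, letters_sortCyc,
        restrict_sortCyc h Finset.subset_union_left, restrict_sortCyc h Finset.subset_union_right]
      exact ⟨hd, rfl, h1, h2⟩
    rw [Finset.card_eq_sum_card_fiberwise hmaps, Nat.cast_sum]
    refine Finset.sum_congr rfl fun τ hτ => ?_
    rw [mem_cyclicShuffles, isCyclicShuffle_iff, ← hs, ← ht] at hτ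
    refine (fundCycQSymComp_apply τ d).trans ?_
    rw [hτ.2.1, Finset.filter_filter]
    congr 2
    -- Sorting into the shuffle τ already forces the conditions on `s` and `t`, by restriction.
    refine Finset.filter_congr fun h _ => ⟨fun hh => ⟨⟨?_, ?_⟩, hh⟩, fun hh => hh.2⟩
    · rw [← restrict_sortCyc h Finset.subset_union_left, hh, hτ.2.2.1]
    · rw [← restrict_sortCyc h Finset.subset_union_right, hh, hτ.2.2.2]
  have hmaps : Set.MapsTo (fun h => (content h s, content h t)) H
      (Finset.HasAntidiagonal.antidiagonal d : Finset ((ℕ+ →₀ ℕ) × (ℕ+ →₀ ℕ))) := by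
    intro h hh
    obtain ⟨h1, -⟩ := Finset.mem_filter.1 hh
    rw [Finset.mem_coe, Finset.HasAntidiagonal.mem_antidiagonal, ← content_union h hd]
    exact (mem_labelings.1 h1).2
  rw [hR, MvPowerSeries.coeff_mul, Finset.card_eq_sum_card_fiberwise hmaps, Nat.cast_sum]
  refine Finset.sum_congr rfl fun x hx => ?_
  have e1 : MvPowerSeries.coeff x.1 (fundCycQSymComp π.cComp) = _ := fundCycQSymComp_apply π x.1
  have e2 : MvPowerSeries.coeff x.2 (fundCycQSymComp σ.cComp) = _ := fundCycQSymComp_apply σ x.2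
  rw [e1, e2, ← Nat.cast_mul, ← Finset.card_product, Nat.cast_inj, ← hs, ← ht]
  have hs' : ∀ f g : ℕ+ → ℕ+, ∀ a ∈ s, (if a ∈ s then f a else g a) = f a :=
    fun f g a ha => if_pos ha
  have ht' : ∀ f g : ℕ+ → ℕ+, ∀ a ∈ t, (if a ∈ s then f a else g a) = g a :=
    fun f g a ha => if_neg (hst ha)
  have hs1 : ∀ f : ℕ+ → ℕ+, ∀ a ∈ s, (if a ∈ s then f a else 1) = f a := fun f a ha => if_pos ha
  have ht1 : ∀ f : ℕ+ → ℕ+, ∀ a ∈ t, (if a ∈ t then f a else 1) = f a := fun f a ha => if_pos ha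
  -- Glue two labelings, or cut one into two. The default label 1 outside the alphabets makes these
  -- operations mutually inverse.
  refine Finset.card_nbij' (fun p a => if a ∈ s then p.1 a else p.2 a)
    (fun h => (fun a => if a ∈ s then h a else 1, fun a => if a ∈ t then h a else 1)) ?_ ?_ ?_ ?_
  · rintro ⟨f, g⟩ hfg
    simp only [Finset.mem_coe, Finset.mem_product, Finset.mem_filter, mem_labelings, H] at hfg ⊢
    obtain ⟨⟨⟨f1, f2⟩, f3⟩, ⟨g1, g2⟩, g3⟩ := hfg
    rw [content_union _ hd, content_congr (hs' f g), content_congr (ht' f g),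
      sortCyc_congr (hs' f g), sortCyc_congr (ht' f g), f2, g2]
    refine ⟨⟨⟨fun a ha => ?_, Finset.HasAntidiagonal.mem_antidiagonal.1 hx⟩, f3, g3⟩, rfl⟩
    rw [Finset.mem_union, not_or] at ha
    rw [if_neg ha.1, g1 a ha.2]
  · intro h hh
    simp only [Finset.mem_coe, Finset.mem_product, Finset.mem_filter, mem_labelings, H] at hh ⊢
    obtain ⟨⟨-, h2, h3⟩, rfl⟩ := hh
    rw [content_congr (hs1 h), content_congr (ht1 h), sortCyc_congr (hs1 h), sortCyc_congr (ht1 h)]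
    exact ⟨⟨⟨fun a ha => if_neg ha, rfl⟩, h2⟩, ⟨fun a ha => if_neg ha, rfl⟩, h3⟩
  · rintro ⟨f, g⟩ hfg
    simp only [Finset.mem_coe, Finset.mem_product, Finset.mem_filter, mem_labelings] at hfg
    refine Prod.ext (funext fun a => ?_) (funext fun a => ?_)
    · by_cases ha : a ∈ s
      · simp [ha]
      · simp [ha, hfg.1.1.1 a ha]
    · by_cases ha : a ∈ t
      · simp [ha, hst ha]
      · simp [ha, hfg.2.1.1 a ha]
  · intro h hh
    simp only [Finset.mem_coe, Finset.mem_filter, mem_labelings, H] at hh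
    funext a
    by_cases ha : a ∈ s
    · simp [ha]
    · by_cases ha' : a ∈ t
      · simp [ha, ha']
      · simp [ha, ha', hh.1.1.1 a (by simp [ha, ha'])]

/-! ## Compositions and their partial sums -/

/-- The partial sums of a composition, starting from `b` (which is left out). -/
def partialSums : ℕ → List ℕ+ → List ℕ
  | _, [] => []
  | b, a :: l => (b + a) :: partialSums (b + a) l

theorem toFinset_partialSums (b : ℕ) (l : List ℕ+) :
    (partialSums b l).toFinset = (compDes l).image (b + ·) := by
  induction l generalizing b with
  | nil => simp [partialSums, compDes]
  | cons a l ih =>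
    rw [partialSums, List.toFinset_cons, ih, compDes_cons, Finset.image_insert, Finset.image_image]
    congr 1
    exact Finset.image_congr fun x _ => by simp [add_assoc]

theorem pairwise_partialSums (b : ℕ) (l : List ℕ+) : (b :: partialSums b l).Pairwise (· < ·) := by
  induction l generalizing b with
  | nil => simp [partialSums]
  | cons a l ih =>
    rw [partialSums, List.pairwise_cons]
    have h := ih (b + a)
    have ha := a.pos
    refine ⟨fun x hx => ?_, h⟩
    rcases List.mem_cons.1 hx with rfl | hx
    · omega
    · have := (List.pairwise_cons.1 h).1 x hx
      omega

theorem length_partialSums (b : ℕ) (l : List ℕ+) : (partialSums b l).length = l.length := by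
  induction l generalizing b with
  | nil => rfl
  | cons a l ih => simp [partialSums, ih]

theorem partialSums_concat (b : ℕ) (l : List ℕ+) (c : ℕ+) :
    partialSums b (l ++ [c]) = partialSums b l ++ [b + size l + c] := by
  induction l generalizing b with
  | nil => simp [partialSums, size]
  | cons a l ih => simp [partialSums, ih, size_cons, add_assoc]

/-- Consecutive differences of partial sums give back the parts; this is the form in which `cComp`
computes them. -/
theorem zipWith_partialSums (b : ℕ) (l : List ℕ+) (c : ℕ+) :
    List.zipWith (fun a b => (b - a).toPNat') (b :: partialSums b l) (partialSums b (l ++ [c])) =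
      l ++ [c] := by
  have h : ∀ (b : ℕ) (a : ℕ+), (b + a - b).toPNat' = a := fun b a => by
    rw [Nat.add_sub_cancel_left, PNat.coe_toPNat']
  induction l generalizing b with
  | nil => simp [partialSums]
  | cons a l ih =>
    rw [List.cons_append, partialSums, partialSums, List.zipWith_cons_cons, ih, h]

/-- Parts are positive, so the partial sums already come in strictly increasing order. -/
theorem sort_compDes (l : List ℕ+) : (compDes l).sort (· ≤ ·) = partialSums 0 l := by
  have h := (List.pairwise_cons.1 (pairwise_partialSums 0 l)).2
  have h1 := (List.toFinset_sort (· ≤ ·) h.nodup).2 (h.imp fun h => h.le)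
  rw [toFinset_partialSums] at h1
  simpa using h1

theorem card_compDes (l : List ℕ+) : (compDes l).card = l.length := by
  rw [← Finset.length_sort (· ≤ ·), sort_compDes, length_partialSums]

theorem size_eq_zero {l : List ℕ+} : size l = 0 ↔ l = [] := by
  rcases l with _ | ⟨a, l⟩
  · simp [size]
  · have := a.pos
    rw [size_cons]
    simp

theorem size_mem_compDes {l : List ℕ+} (hl : l ≠ []) : size l ∈ compDes l := by
  obtain ⟨l, a, rfl⟩ := List.eq_nil_or_concat l |>.resolve_left hl
  rw [List.concat_eq_append, compDes_concat, size_append, size_cons, add_comm]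
  exact Finset.mem_insert_self _ _

/-- `cComp` is a left inverse of `compDes` up to rotation. -/
theorem cComp_compDes (l : List ℕ+) : cComp (size l) (compDes l) ~r l := by
  rcases l with _ | ⟨a, l⟩
  · simp [cComp, size]
  · have ha := a.pos
    rw [cComp, if_neg (by rw [size_cons]; omega)]
    split_ifs with h1
    · rw [size_cons] at h1
      have h2 : size l = 0 := by omega
      have h3 : (a : ℕ) = 1 := by omega
      rw [size_eq_zero.1 h2, PNat.coe_eq_one_iff.1 h3]
    -- The first partial sum is `a` and the last is n, so the wrap-around gap is `a` again. Thus
    -- `cComp` returns `l ++ [a]`, the composition rotated by one.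
    · have e : (partialSums 0 (a :: l)).tail ++ [size (a :: l) + (partialSums 0 (a :: l)).headD 0] =
          partialSums a (l ++ [a]) := by
        rw [partialSums_concat, size_cons]
        simp [partialSums]
      rw [sort_compDes, e, partialSums, zero_add, zipWith_partialSums]
      exact List.IsRotated.symm ⟨1, by simp⟩

theorem cycShift_subset {n : ℕ} {S : Finset ℕ} (hS : S ⊆ Finset.Icc 1 n) (i : ℕ) :
    cycShift n S i ⊆ Finset.Icc 1 n := by
  intro x hx
  obtain ⟨s, hs, rfl⟩ := Finset.mem_image.1 hx
  have := Finset.mem_Icc.1 (hS hs)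
  have := Nat.mod_lt (s + i - 1) (show n > 0 by omega)
  rw [Finset.mem_Icc]
  omega

theorem card_cycShift {n : ℕ} {S : Finset ℕ} (hS : S ⊆ Finset.Icc 1 n) (i : ℕ) :
    (cycShift n S i).card = S.card := by
  refine Finset.card_image_of_injOn fun s hs t ht h => ?_
  have h1 := Finset.mem_Icc.1 (hS hs)
  have h2 := Finset.mem_Icc.1 (hS ht)
  have h3 : (s - 1) + i ≡ (t - 1) + i [MOD n] := by
    rw [Nat.ModEq, show s - 1 + i = s + i - 1 by omega, show t - 1 + i = t + i - 1 by omega]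
    exact Nat.succ_injective h
  have h4 := (Nat.ModEq.add_right_cancel' i h3).eq_of_lt_of_lt (by omega) (by omega)
  omega

theorem cComp_cycShift_isRotated {n : ℕ} {S : Finset ℕ} (hS : S ⊆ Finset.Icc 1 n) (i : ℕ) :
    cComp n (cycShift n S i) ~r cComp n S := by
  induction i with
  | zero => rw [cycShift_zero hS]
  | succ i ih =>
    rw [← cycShift_cycShift hS]
    exact (cComp_cycShift n _ (cycShift_subset hS i)).trans ih

/-! ## Linear independence of the fundamental cyclic quasisymmetric functions -/

/-- The slowest weakly increasing sequence of length `n` that increases after all positions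
in `V`. -/
def stepSeq (n : ℕ) (V : Finset ℕ) (j : Fin n) : ℕ+ := (V.filter (· ≤ j.1)).card.succPNat

/-- The exponent of the monomial of `stepSeq n V`. -/
def stepExp (n : ℕ) (V : Finset ℕ) : ℕ+ →₀ ℕ := ∑ j, Finsupp.single (stepSeq n V j) 1

theorem monotone_stepSeq (n : ℕ) (V : Finset ℕ) : Monotone (stepSeq n V) := by
  intro j k hjk
  refine Nat.succPNat_le_succPNat.2 (Finset.card_le_card ?_)
  exact Finset.monotone_filter_right _ fun x _ hx => le_trans hx hjk

theorem stepSeq_lt_iff {n : ℕ} {V : Finset ℕ} {j k : Fin n} (h : k.1 = j.1 + 1) :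
    stepSeq n V j < stepSeq n V k ↔ k.1 ∈ V := by
  rw [stepSeq, stepSeq, Nat.succPNat_lt_succPNat]
  constructor
  · intro hlt
    by_contra hk
    refine hlt.ne (congrArg Finset.card (Finset.filter_congr fun x hx => ?_))
    have : x ≠ k.1 := fun e => hk (e ▸ hx)
    omega
  · intro hk
    refine Finset.card_lt_card (Finset.ssubset_iff_of_subset ?_ |>.2 ⟨k.1, ?_, ?_⟩)
    · exact Finset.monotone_filter_right _ fun x _ hx => by omega
    · simp [hk]
    · simp [h]

/-- A weakly increasing sequence is determined by its monomial. -/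
theorem eq_of_monotone_of_sum_single_eq {n : ℕ} {f g : Fin n → ℕ+} (hf : Monotone f)
    (hg : Monotone g) (h : ∑ j, Finsupp.single (f j) 1 = ∑ j, Finsupp.single (g j) 1) : f = g := by
  have key : ∀ f : Fin n → ℕ+, Finsupp.toMultiset (∑ j, Finsupp.single (f j) 1) =
      (List.ofFn f : Multiset ℕ+) := by
    intro f
    rw [map_sum, ← Fin.univ_val_map]
    simp only [Finsupp.toMultiset_single, one_smul]
    rw [← Multiset.sum_map_singleton (Multiset.map f _), Multiset.map_map]
    rfl
  have h' := congrArg Finsupp.toMultiset h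
  rw [key, key, Multiset.coe_eq_coe] at h'
  exact List.ofFn_injective (h'.eq_of_sortedLE hf.sortedLE_ofFn hg.sortedLE_ofFn)

/-- Only `stepSeq n V` has this monomial among weakly increasing sequences, and it is strict
precisely at the positions in `V`. -/
theorem fundQSym_stepExp {n : ℕ} {S : Finset ℕ} (V : Finset ℕ) (hS : S ⊆ Finset.Icc 1 (n - 1)) :
    fundQSym n S (stepExp n V) = if S ⊆ V then 1 else 0 := by
  rw [fundQSym]
  split_ifs with h
  · rw [Nat.cast_eq_one, Nat.card_eq_one_iff_unique]
    refine ⟨⟨fun i j => Subtype.ext ?_⟩, ⟨stepSeq n V, monotone_stepSeq n V, fun j k hjk hk => ?_,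
      rfl⟩⟩
    · exact eq_of_monotone_of_sum_single_eq i.2.1 j.2.1 (i.2.2.2.trans j.2.2.2.symm)
    · exact (stepSeq_lt_iff hjk).2 (h hk)
  · rw [Nat.cast_eq_zero, Nat.card_eq_zero]
    refine Or.inl ⟨fun ⟨i, hi, hi2, hi3⟩ => h fun s hs => ?_⟩
    obtain rfl := eq_of_monotone_of_sum_single_eq hi (monotone_stepSeq n V) hi3
    have := Finset.mem_Icc.1 (hS hs)
    exact (stepSeq_lt_iff (j := ⟨s - 1, by omega⟩) (k := ⟨s, by omega⟩)
      (by simp only; omega)).1 (hi2 _ _ (by simp only; omega) hs)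

theorem fundQSym_eq_zero {n : ℕ} {S : Finset ℕ} {d : ℕ+ →₀ ℕ} (hd : d.degree ≠ n) :
    fundQSym n S d = 0 := by
  rw [fundQSym, Nat.cast_eq_zero, Nat.card_eq_zero]
  refine Or.inl ⟨fun ⟨i, hi, hi2, hi3⟩ => hd ?_⟩
  rw [← hi3, map_sum]
  simp [Finsupp.degree_single]

theorem degree_stepExp (n : ℕ) (V : Finset ℕ) : (stepExp n V).degree = n := by
  rw [stepExp, map_sum]
  simp [Finsupp.degree_single]

theorem coeff_fundCycQSym_eq_zero {n : ℕ} {S : Finset ℕ} {d : ℕ+ →₀ ℕ} (hd : d.degree ≠ n) :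
    MvPowerSeries.coeff d (fundCycQSym n S) = 0 := by
  rw [fundCycQSym]
  split_ifs with h
  · rw [MvPowerSeries.coeff_one, if_neg]
    rintro rfl
    exact hd (by simp [h])
  · rw [map_sum]
    exact Finset.sum_eq_zero fun i _ => fundQSym_eq_zero hd

/-- Each shift of `S` contained in `V` contributes 1. The truncation to [n-1] loses nothing, because
n lies in `V`. -/
theorem coeff_fundCycQSym_stepExp {n : ℕ} {S V : Finset ℕ} (hn : n ≠ 0) (hS : S ⊆ Finset.Icc 1 n)
    (hV : n ∈ V) : MvPowerSeries.coeff (stepExp n V) (fundCycQSym n S) =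
      (((Finset.Icc 1 n).filter fun i => cycShift n S i ⊆ V).card : ℚ) := by
  rw [fundCycQSym, if_neg hn, map_sum, Finset.card_filter, Nat.cast_sum]
  refine Finset.sum_congr rfl fun i _ => ?_
  refine (fundQSym_stepExp V Finset.inter_subset_right).trans ?_
  have : cycShift n S i ∩ Finset.Icc 1 (n - 1) ⊆ V ↔ cycShift n S i ⊆ V := by
    refine ⟨fun h x hx => ?_, fun h => Finset.inter_subset_left.trans h⟩
    have hx' := Finset.mem_Icc.1 (cycShift_subset hS i hx)
    by_cases hxn : x = n
    · rwa [hxn]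
    · exact h (Finset.mem_inter.2 ⟨hx, Finset.mem_Icc.2 ⟨hx'.1, by omega⟩⟩)
  simp [this]

/-- The leading coefficient of `F^cyc_{[L]}` does not vanish. -/
theorem coeff_fundCycQSym_self_ne_zero (l : List ℕ+) :
    MvPowerSeries.coeff (stepExp (size l) (compDes l)) (fundCycQSym (size l) (compDes l)) ≠ 0 := by
  rcases eq_or_ne l [] with rfl | hl
  · have : size [] = 0 := rfl
    rw [fundCycQSym, if_pos this, MvPowerSeries.coeff_one, if_pos]
    · exact one_ne_zero
    · exact Finset.sum_eq_zero fun j => absurd j.2 (by simp [this])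
  · have hn : size l ≠ 0 := mt size_eq_zero.1 hl
    rw [coeff_fundCycQSym_stepExp hn (compDes_subset l) (size_mem_compDes hl), Nat.cast_ne_zero,
      ← Nat.pos_iff_ne_zero, Finset.card_pos]
    -- Shifts are indexed by 1, …, n, so the identity shift appears as the shift by n.
    refine ⟨size l, Finset.mem_filter.2 ⟨Finset.mem_Icc.2 ⟨by omega, le_rfl⟩, ?_⟩⟩
    have h : cycShift (size l) (compDes l) (size l) = cycShift (size l) (compDes l) 0 := by
      refine Finset.image_congr fun s hs => ?_
      have := Finset.mem_Icc.1 (compDes_subset l hs)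
      change (s + size l - 1) % size l + 1 = (s + 0 - 1) % size l + 1
      rw [show s + size l - 1 = s + 0 - 1 + size l by omega, Nat.add_mod_right]
    rw [h, cycShift_zero (compDes_subset l)]

/-- The leading monomial of `F^cyc_{[L]}` appears in `F^cyc_{[K]}` only for shorter `K` and
for `[K] = [L]`. -/
theorem isRotated_of_coeff_fundCycQSym_ne_zero {l k : List ℕ+} (hlen : l.length ≤ k.length)
    (h : MvPowerSeries.coeff (stepExp (size l) (compDes l)) (fundCycQSym (size k) (compDes k)) ≠ 0) :
    k ~r l := by
  have hsize : size l = size k := by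
    by_contra hne
    exact h (coeff_fundCycQSym_eq_zero (by rwa [degree_stepExp]))
  rcases eq_or_ne l [] with rfl | hl
  · have : size k = 0 := hsize.symm
    rw [size_eq_zero.1 this]
  · have hn : size l ≠ 0 := mt size_eq_zero.1 hl
    have hk := compDes_subset k
    rw [← hsize] at h hk
    rw [coeff_fundCycQSym_stepExp hn hk (size_mem_compDes hl), Nat.cast_ne_zero,
      ← Nat.pos_iff_ne_zero, Finset.card_pos] at h
    obtain ⟨i, hi⟩ := h
    have h1 := (Finset.mem_filter.1 hi).2
    -- A shift of `compDes k` lies in `compDes l` and has at least as many elements, so the two sets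
    -- coincide.
    have h2 := Finset.eq_of_subset_of_card_le h1 (by
      rwa [card_cycShift hk, card_compDes, card_compDes])
    have h3 := cComp_cycShift_isRotated hk i
    rw [h2] at h3
    have h4 := cComp_compDes k
    rw [← hsize] at h4
    exact h4.symm.trans (h3.symm.trans (cComp_compDes l))

/-- Triangularity: in a nontrivial relation take a composition with the fewest parts. Its leading
monomial occurs in no other term of the relation, so its coefficient would have to vanish. -/
theorem linearIndependent_fundCycQSymComp : LinearIndependent ℚ fundCycQSymComp := by
  rw [linearIndependent_iff]
  intro c hc
  by_contra hne
  obtain ⟨L, hL, hmin⟩ := Finset.exists_min_image c.support Cycle.length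
    (Finsupp.support_nonempty_iff.2 hne)
  induction L using Quotient.inductionOn with
  | h l =>
    have h := congrArg (MvPowerSeries.coeff (stepExp (size l) (compDes l))) hc
    rw [Finsupp.linearCombination_apply, Finsupp.sum, map_sum, map_zero] at h
    rw [Finset.sum_eq_single_of_mem _ hL] at h
    · rw [MvPowerSeries.coeff_smul] at h
      exact (mul_ne_zero (Finsupp.mem_support_iff.1 hL) (coeff_fundCycQSym_self_ne_zero l)) h
    · intro K hK hne
      have hKmin := hmin K hK
      induction K using Quotient.inductionOn with
      | h k =>
        rw [MvPowerSeries.coeff_smul, mul_eq_zero]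
        right
        by_contra h'
        exact hne (Quotient.sound (isRotated_of_coeff_fundCycQSym_ne_zero hKmin h'))

/-! ## The algebra `cQSym⁻` -/

theorem cDes_eq_of_sameRelOrder {p q : List ℕ+} (h : SameRelOrder p q) : cDes p = cDes q := by
  obtain ⟨hlen, h⟩ := h
  ext i
  simp only [cDes, Finset.mem_filter, Finset.mem_Icc, hlen]
  refine and_congr_right fun hi => ?_
  have hlt : i % q.length < q.length := Nat.mod_lt _ (by omega)
  have hlt' : i - 1 < q.length := by omega
  rw [List.getD_eq_getElem _ _ hlt, List.getD_eq_getElem _ _ hlt',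
    List.getD_eq_getElem _ _ (hlen ▸ hlt), List.getD_eq_getElem _ _ (hlen ▸ hlt')]
  exact h ⟨_, hlen ▸ hlt⟩ ⟨_, hlen ▸ hlt'⟩

/-- The cyclic descent composition as a cyclic permutation statistic. -/
def cCompStatistic : CyclicStatistic (Cycle ℕ+) where
  toFun := CyclicPerm.cComp
  relOrder p q hp hq h := by
    change ((cComp p.length (cDes p) : List ℕ+) : Cycle ℕ+) = (cComp q.length (cDes q) : List ℕ+)
    rw [cDes_eq_of_sameRelOrder h, h.choose]

/-- Every non-Escher cyclic composition is realized by letters outside of a given finite set. -/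
theorem exists_nonEscherComp_eq (L : NonEscherComp) (s : Finset ℕ+) :
    ∃ π : CyclicPerm, π.nonEscherComp = L ∧ Disjoint π.letters s := by
  obtain ⟨σ, hσ⟩ := exists_cComp_eq L
  -- Equivalence for the statistic cComp preserves the cyclic descent composition, so
  -- representatives with fresh letters serve here.
  obtain ⟨π, hπ, hd⟩ := cCompStatistic.exists_rep_disjoint (cCompStatistic.permClass σ) s
  exact ⟨π, Subtype.ext ((Quotient.exact hπ).1.trans hσ), hd⟩

theorem cycSize_cComp (π : CyclicPerm) : cycSize π.cComp = π.length := by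
  induction π using CyclicPerm.ind with
  | h l hl => exact (fundCycQSymComp_cComp ⟨l, hl, rfl, rfl⟩).1

theorem fund_nonEscherComp_mul {π σ : CyclicPerm} (h : Disjoint π.letters σ.letters) :
    π.nonEscherComp.fund * σ.nonEscherComp.fund =
      ∑ τ ∈ cyclicShuffles π σ, τ.nonEscherComp.fund := by
  refine Subtype.ext ?_
  rw [AddSubmonoidClass.coe_finsetSum]
  exact fundCycQSymComp_mul h

open CyclicStatistic.ShuffleAlgebra in
theorem fund_emptyPerm : emptyPerm.nonEscherComp.fund = 1 := by
  refine Subtype.ext ?_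
  change fundCycQSym 0 (compDes []) = 1
  rw [fundCycQSym, if_pos rfl]

theorem range_fund : Set.range (fun L : NonEscherComp => (L.fund : MvPowerSeries ℕ+ ℚ)) =
    nonEscherFund := by
  ext f
  constructor
  · rintro ⟨⟨_, n, S, h, rfl⟩, rfl⟩
    exact ⟨n, S, h, (fundCycQSymComp_cComp h).2⟩
  · rintro ⟨n, S, h, rfl⟩
    exact ⟨⟨_, n, S, h, rfl⟩, (fundCycQSymComp_cComp h).2⟩

/-- `cQSym⁻` is the linear span of the non-Escher fundamental functions. -/
theorem toSubmodule_cQSymMinus :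
    Subalgebra.toSubmodule cQSymMinus = Submodule.span ℚ nonEscherFund := by
  rw [cQSymMinus, Algebra.adjoin_eq_span]
  refine le_antisymm (Submodule.span_le.2 fun x hx => ?_)
    (Submodule.span_mono Submonoid.subset_closure)
  -- By bilinearity, only products of two generators matter. On disjoint alphabets these are sums
  -- over shuffles, and every cyclic permutation has a non-Escher composition.
  have hmul : ∀ x ∈ Submodule.span ℚ nonEscherFund, ∀ y ∈ Submodule.span ℚ nonEscherFund,
      x * y ∈ Submodule.span ℚ nonEscherFund := by
    intro x hx y hy
    rw [← range_fund] at hx hy ⊢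
    have hxy := Submodule.mul_mem_mul hx hy
    rw [Submodule.span_mul_span] at hxy
    refine Submodule.span_le.2 ?_ hxy
    rintro _ ⟨_, ⟨L, rfl⟩, _, ⟨K, rfl⟩, rfl⟩
    obtain ⟨π, rfl, -⟩ := exists_nonEscherComp_eq L ∅
    obtain ⟨σ, rfl, hd⟩ := exists_nonEscherComp_eq K π.letters
    have h := congrArg Subtype.val (fund_nonEscherComp_mul hd.symm)
    rw [AddSubmonoidClass.coe_finsetSum] at h
    change (π.nonEscherComp.fund * σ.nonEscherComp.fund : cQSymMinus).1 ∈ _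
    rw [h]
    exact Submodule.sum_mem _ fun τ _ => Submodule.subset_span ⟨τ.nonEscherComp, rfl⟩
  induction hx using Submonoid.closure_induction with
  | mem x hx => exact Submodule.subset_span hx
  | one =>
    rw [← range_fund]
    exact Submodule.subset_span ⟨_, congrArg Subtype.val fund_emptyPerm⟩
  | mul x y _ _ hx hy => exact hmul x hx y hy

/-- The non-Escher fundamental functions form a basis of `cQSym⁻`. -/
def fundBasis : Module.Basis NonEscherComp ℚ cQSymMinus :=
  Module.Basis.mk (v := NonEscherComp.fund)
    (LinearIndependent.of_comp cQSymMinus.val.toLinearMap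
      (linearIndependent_fundCycQSymComp.comp _ Subtype.val_injective))
    (by
      rintro ⟨x, hx⟩ -
      rw [← Subalgebra.mem_toSubmodule, toSubmodule_cQSymMinus, ← range_fund] at hx
      have e : Set.range (fun L : NonEscherComp => (L.fund : MvPowerSeries ℕ+ ℚ)) =
          cQSymMinus.val.toLinearMap '' Set.range NonEscherComp.fund := by
        rw [← Set.range_comp]
        rfl
      rw [e, ← Submodule.map_span] at hx
      obtain ⟨y, hy, hyx⟩ := hx
      rwa [← show y = ⟨x, _⟩ from Subtype.ext hyx])

theorem fundBasis_apply (L : NonEscherComp) : fundBasis L = L.fund :=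
  Module.Basis.mk_apply _ _ L

/-! ### Equivalence classes of permutations and of compositions -/

namespace CyclicStatistic

variable {X : Type*} {cst : CyclicStatistic X}

theorem compClass_eq_iff (h : cst.IsDescent) {π σ : CyclicPerm} :
    cst.compClass π.nonEscherComp = cst.compClass σ.nonEscherComp ↔
      cst.permClass π = cst.permClass σ := by
  have key : cst.onComp π.nonEscherComp = cst.onComp σ.nonEscherComp ∧
      cycSize π.cComp = cycSize σ.cComp ↔ cst π = cst σ ∧ π.length = σ.length := by
    rw [cst.onComp_nonEscherComp h, cst.onComp_nonEscherComp h, cycSize_cComp, cycSize_cComp]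
  exact ⟨fun hh => Quotient.sound (key.1 (Quotient.exact hh)),
    fun hh => Quotient.sound (key.2 (Quotient.exact hh))⟩

/-- The correspondence between the `cst`-equivalence classes of cyclic permutations and of
non-Escher cyclic compositions. -/
def classEquiv (h : cst.IsDescent) : cst.PermClass ≃ cst.CompClass :=
  Equiv.ofBijective
    (Quotient.lift (fun π : CyclicPerm => cst.compClass π.nonEscherComp) fun _ _ hh =>
      (compClass_eq_iff h).2 (Quotient.sound hh)) <| by
    constructor
    · intro a b hab
      induction a using Quotient.inductionOn with
      | h π =>
        induction b using Quotient.inductionOn with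
        | h σ => exact (compClass_eq_iff h).1 hab
    · intro α
      induction α using Quotient.inductionOn with
      | h L =>
        obtain ⟨π, rfl, -⟩ := exists_nonEscherComp_eq L ∅
        exact ⟨cst.permClass π, rfl⟩

theorem classEquiv_permClass (h : cst.IsDescent) (π : CyclicPerm) :
    classEquiv h (cst.permClass π) = cst.compClass π.nonEscherComp := rfl

/-! ### From a homomorphism on cQSym⁻ to compatibility and the isomorphism -/

section Homomorphism

variable {A : Type*} [Ring A] [Algebra ℚ A] {v : Module.Basis cst.CompClass ℚ A}
  {φ : cQSymMinus →ₐ[ℚ] A}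

theorem basis_mul_basis (hφ : ∀ L : NonEscherComp, φ L.fund = v (cst.compClass L))
    {π σ : CyclicPerm} (h : Disjoint π.letters σ.letters) :
    v (cst.compClass π.nonEscherComp) * v (cst.compClass σ.nonEscherComp) =
      ∑ τ ∈ cyclicShuffles π σ, v (cst.compClass τ.nonEscherComp) := by
  simp only [← hφ]
  rw [← map_mul, fund_nonEscherComp_mul h, map_sum]

/-- Finite sums of basis vectors determine the multiset of their indices. -/
theorem map_eq_map_of_sum_basis_eq {ι κ : Type*} (v : Module.Basis κ ℚ A) {s t : Finset ι}
    {f : ι → κ} (h : ∑ i ∈ s, v (f i) = ∑ i ∈ t, v (f i)) : s.val.map f = t.val.map f := by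
  classical
  ext k
  -- The coordinate at `k` is the multiplicity of `k`; nothing is lost, since ℕ embeds in ℚ.
  have key : ∀ s : Finset ι, v.repr (∑ i ∈ s, v (f i)) k = ((s.val.map f).count k : ℚ) := by
    intro s
    rw [map_sum, Finsupp.finsetSum_apply, Multiset.count_map]
    simp only [Module.Basis.repr_self, Finsupp.single_apply]
    rw [← Finset.filter_val, Finset.card_val, Finset.card_filter, Nat.cast_sum]
    exact Finset.sum_congr rfl fun i _ => by simp [eq_comm]
  have := congrArg (fun x => v.repr x k) h
  simpa only [key, Nat.cast_inj] using this

/-- The product of two basis vectors depends only on the two classes, and its coordinates count the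
shuffles in each class. -/
theorem shuffleCompatible_of_algHom (hcst : cst.IsDescent)
    (hφ : ∀ L : NonEscherComp, φ L.fund = v (cst.compClass L)) : cst.ShuffleCompatible := by
  intro π σ π' σ' hd hd' h1 h2 h3 h4
  have hπ : cst.compClass π.nonEscherComp = cst.compClass π'.nonEscherComp :=
    (compClass_eq_iff hcst).2 (Quotient.sound ⟨h1, h3⟩)
  have hσ : cst.compClass σ.nonEscherComp = cst.compClass σ'.nonEscherComp :=
    (compClass_eq_iff hcst).2 (Quotient.sound ⟨h2, h4⟩)
  have h := basis_mul_basis hφ hd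
  rw [hπ, hσ, basis_mul_basis hφ hd'] at h
  have hm := map_eq_map_of_sum_basis_eq v (f := fun τ : CyclicPerm => cst.compClass τ.nonEscherComp) h
  -- The class of a composition determines the value of `cst`, so equal multisets of classes give
  -- equal multisets of values.
  let val : cst.CompClass → X := Quotient.lift cst.onComp fun _ _ hh => hh.1
  have hval : ∀ τ : CyclicPerm, val (cst.compClass τ.nonEscherComp) = cst τ :=
    cst.onComp_nonEscherComp hcst
  have hm' := congrArg (Multiset.map val) hm
  simp only [Multiset.map_map, Function.comp_def, hval] at hm'
  exact hm'.symm

/-- The basis `[π]_cst` of the cyclic shuffle algebra. -/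
def shuffleBasis (hc : cst.ShuffleCompatible) :
    Module.Basis cst.PermClass ℚ (cst.ShuffleAlgebra hc) :=
  Module.Basis.ofRepr (LinearEquiv.refl ℚ (cst.PermClass →₀ ℚ))

theorem shuffleBasis_permClass (hc : cst.ShuffleCompatible) (π : CyclicPerm) :
    shuffleBasis hc (cst.permClass π) = ShuffleAlgebra.of hc π := rfl

/-- The algebra isomorphism `[π]_cst ↦ v_α`, `cComp [π] ∈ α`. -/
theorem exists_algEquiv (hcst : cst.IsDescent)
    (hφ : ∀ L : NonEscherComp, φ L.fund = v (cst.compClass L)) (hc : cst.ShuffleCompatible) :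
    ∃ e : cst.ShuffleAlgebra hc ≃ₐ[ℚ] A, ∀ π : CyclicPerm,
      e (ShuffleAlgebra.of hc π) = v (cst.compClass π.nonEscherComp) := by
  let e := (shuffleBasis hc).equiv v (classEquiv hcst)
  have he : ∀ π : CyclicPerm, e (ShuffleAlgebra.of hc π) = v (cst.compClass π.nonEscherComp) := by
    intro π
    rw [← shuffleBasis_permClass, Module.Basis.equiv_apply, classEquiv_permClass]
  refine ⟨AlgEquiv.ofLinearEquiv e ?_ fun x y => ?_, he⟩
  · rw [ShuffleAlgebra.one_def, he, ← hφ, fund_emptyPerm, map_one]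
  -- Multiplicativity is bilinear, so it is checked on basis elements. The second one is represented
  -- by letters avoiding the first, where both products are sums over the same shuffles.
  · induction x using ShuffleAlgebra.induction ∅ with
    | h0 => simp
    | hadd a b ha hb => rw [add_mul, map_add, map_add, ha, hb, add_mul]
    | hsmul r a ha => rw [smul_mul_assoc, map_smul, map_smul, ha, smul_mul_assoc]
    | hof π =>
      induction y using ShuffleAlgebra.induction π.letters with
      | h0 => simp
      | hadd a b ha hb => rw [mul_add, map_add, map_add, ha, hb, mul_add]
      | hsmul r a ha => rw [mul_smul_comm, map_smul, map_smul, ha, mul_smul_comm]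
      | hof σ hσ =>
        rw [ShuffleAlgebra.of_mul_of hσ.symm, map_sum, he, he, basis_mul_basis hφ hσ.symm]
        exact Finset.sum_congr rfl fun τ _ => he τ

end Homomorphism

/-! ### From compatibility to a homomorphism on cQSym⁻ -/

/-- The linear map `F^cyc_{[L]} ↦ [π]_cst`, `cComp [π] = [L]`. -/
def fundLinearMap (hcst : cst.IsDescent) (hc : cst.ShuffleCompatible) :
    cQSymMinus →ₗ[ℚ] cst.ShuffleAlgebra hc :=
  fundBasis.constr ℚ fun L => shuffleBasis hc ((classEquiv hcst).symm (cst.compClass L))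

theorem fundLinearMap_fund (hcst : cst.IsDescent) (hc : cst.ShuffleCompatible)
    (L : NonEscherComp) : fundLinearMap hcst hc L.fund =
      shuffleBasis hc ((classEquiv hcst).symm (cst.compClass L)) := by
  rw [← fundBasis_apply, fundLinearMap, Module.Basis.constr_basis]

theorem fundLinearMap_nonEscherComp (hcst : cst.IsDescent) (hc : cst.ShuffleCompatible)
    (π : CyclicPerm) :
    fundLinearMap hcst hc π.nonEscherComp.fund = ShuffleAlgebra.of hc π := by
  rw [fundLinearMap_fund, ← classEquiv_permClass hcst, Equiv.symm_apply_apply,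
    shuffleBasis_permClass]

/-- The algebra homomorphism `F^cyc_{[L]} ↦ [π]_cst`, `cComp [π] = [L]`. -/
def fundAlgHom (hcst : cst.IsDescent) (hc : cst.ShuffleCompatible) :
    cQSymMinus →ₐ[ℚ] cst.ShuffleAlgebra hc :=
  AlgHom.ofLinearMap (fundLinearMap hcst hc)
    (by rw [← fund_emptyPerm, fundLinearMap_nonEscherComp, ShuffleAlgebra.one_def])
    (by
      -- Multiplicativity becomes an equality of bilinear maps, which is tested on pairs from
      -- `fundBasis` realized on disjoint alphabets.
      rw [LinearMap.map_mul_iff]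
      refine fundBasis.ext fun L => fundBasis.ext fun K => ?_
      obtain ⟨π, rfl, -⟩ := exists_nonEscherComp_eq L ∅
      obtain ⟨σ, rfl, hd⟩ := exists_nonEscherComp_eq K π.letters
      change fundLinearMap hcst hc (fundBasis _ * fundBasis _) =
        fundLinearMap hcst hc (fundBasis _) * fundLinearMap hcst hc (fundBasis _)
      rw [fundBasis_apply, fundBasis_apply, fund_nonEscherComp_mul hd.symm, map_sum,
        fundLinearMap_nonEscherComp, fundLinearMap_nonEscherComp,
        ShuffleAlgebra.of_mul_of hd.symm]
      exact Finset.sum_congr rfl fun τ _ => fundLinearMap_nonEscherComp hcst hc τ)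

theorem fundAlgHom_surjective (hcst : cst.IsDescent) (hc : cst.ShuffleCompatible) :
    Function.Surjective (fundAlgHom hcst hc) := by
  intro x
  induction x using ShuffleAlgebra.induction ∅ with
  | h0 => exact ⟨0, map_zero _⟩
  | hadd a b ha hb =>
    obtain ⟨a, rfl⟩ := ha
    obtain ⟨b, rfl⟩ := hb
    exact ⟨a + b, map_add _ a b⟩
  | hsmul r a ha =>
    obtain ⟨a, rfl⟩ := ha
    exact ⟨r • a, map_smul _ r a⟩
  | hof π => exact ⟨π.nonEscherComp.fund, fundLinearMap_nonEscherComp hcst hc π⟩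

end CyclicStatistic

end CyclicShuffle

end

theorem theorem3p5 {X : Type*} (cst : CyclicStatistic X) (hcst : cst.IsDescent) :
    -- `cQSym⁻` is the linear span of the `F^cyc_{n,[S]}`, `S` non-Escher
    Subalgebra.toSubmodule cQSymMinus = Submodule.span ℚ nonEscherFund ∧
    -- the criterion
    (cst.ShuffleCompatible ↔
      ∃ (A : Type) (_ : Ring A) (_ : Algebra ℚ A) (v : Module.Basis cst.CompClass ℚ A)
        (φ : cQSymMinus →ₐ[ℚ] A), ∀ L : NonEscherComp, φ L.fund = v (cst.compClass L)) ∧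
    -- for every such homomorphism, `[π]_cst ↦ v_α` (`cComp [π] ∈ α`) is an algebra isomorphism
    (∀ (A : Type*) [Ring A] [Algebra ℚ A] (v : Module.Basis cst.CompClass ℚ A)
        (φ : cQSymMinus →ₐ[ℚ] A), (∀ L : NonEscherComp, φ L.fund = v (cst.compClass L)) →
      ∃ (hc : cst.ShuffleCompatible) (e : cst.ShuffleAlgebra hc ≃ₐ[ℚ] A),
        ∀ π : CyclicPerm,
          e (CyclicStatistic.ShuffleAlgebra.of hc π) = v (cst.compClass π.nonEscherComp)) ∧
    -- the cyclic shuffle algebra is a quotient of `cQSym⁻`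
    (∀ hc : cst.ShuffleCompatible, ∃ I : Ideal cQSymMinus,
      Nonempty ((cQSymMinus ⧸ I) ≃ₐ[ℚ] cst.ShuffleAlgebra hc)) := by
  refine ⟨toSubmodule_cQSymMinus, ⟨fun hc => ?_, ?_⟩, ?_, fun hc => ?_⟩
  -- The shuffle algebra itself serves as A, its basis reindexed by classes of compositions. It
  -- lives in `Type` whatever the universe of `X`, since it is built on classes of cyclic
  -- permutations.
  · exact ⟨cst.ShuffleAlgebra hc, inferInstance, inferInstance,
      (CyclicStatistic.shuffleBasis hc).reindex (CyclicStatistic.classEquiv hcst),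
      CyclicStatistic.fundAlgHom hcst hc, fun L => by
        rw [Module.Basis.reindex_apply]
        exact CyclicStatistic.fundLinearMap_fund hcst hc L⟩
  · rintro ⟨A, _, _, v, φ, hφ⟩
    exact CyclicStatistic.shuffleCompatible_of_algHom hcst hφ
  · intro A _ _ v φ hφ
    have hc := CyclicStatistic.shuffleCompatible_of_algHom hcst hφ
    exact ⟨hc, CyclicStatistic.exists_algEquiv hcst hφ hc⟩
  · exact ⟨_, ⟨Ideal.quotientKerAlgEquivOfSurjective
      (CyclicStatistic.fundAlgHom_surjective hcst hc)⟩⟩
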